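/- For $s,h>0$ and $n\ge 0$ let $\mathcal S_{s,h}(\mathbf R^n)$ be the space of all $f\in C^\infty(\mathbf R^n)$ (complex-valued) with $$\|f\|_{\mathcal S_{s,h}}=\sup_{\alpha,\beta\in\mathbf N^n,\ x\in\mathbf R^n}\frac{|x^\beta\partial^\alpha f(x)|}{h^{|\alpha|+|\beta|}\,\alpha!^s\,\beta!^s}<\infty ,$$ let $\mathcal S_{1/2}(\mathbf R^n)=\bigcup_{h>0}\mathcal S_{1/2,h}(\mathbf R^n)$ be the Gelfand–Shilov space of order $1/2$, and let $\mathcal S_{1/2}'(\mathbf R^n)=\bigcap_{h>0}\mathcal S_{1/2,h}'(\mathbf R^n)$ be its dual, that is, the space of linear functionals on $\mathcal S_{1/2}(\mathbf R^n)$ whose restriction to each $\mathcal S_{1/2,h}(\mathbf R^n)$ is bounded. Let $\mathscr F f(\xi)=(2\pi)^{-n/2}\int_{\mathbf R^n} f(x)e^{-i\langle x,\xi\rangle}\,dx$ be the Fourier transform, extended to $\mathcal S_{1/2}'(\mathbf R^n)$ by duality, and let $\mathscr F_2$ be the partial Fourier transform on $\mathcal S_{1/2}'(\mathbf R^{2d})=\mathcal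 S_{1/2}'(\mathbf R^{d}\times\mathbf R^{d})$ with respect to the second variable. For $a\in\mathcal S_{1/2}'(\mathbf R^{2d})$ and a real $d\times d$ matrix $A$, let $\operatorname{Op}_A(a)$ be the linear operator from $\mathcal S_{1/2}(\mathbf R^d)$ to $\mathcal S_{1/2}'(\mathbf R^d)$ with distribution kernel $$K_{a,A}(x,y)=(2\pi)^{-d/2}(\mathscr F_2^{-1}a)(x-A(x-y),\,x-y),$$ that is, $\langle \operatorname{Op}_A(a)f,g\rangle=\langle K_{a,A},g\otimes f\rangle$ for $f,g\in\mathcal S_{1/2}(\mathbf R^d)$ with respect to the bilinear dual pairings. Moreover, with $D=-i\partial$, let $e^{i\langle AD_\xi,D_x\rangle}a\in\mathcal S_{1/2}'(\mathbf R^{2d})$ be the distribution whose Fourier transform is $e^{i\langle Az,\eta\rangle}\,\widehat a(\eta,z)$, where $\eta$ and $z$ are the dual variables of $x$ and $\xi$, respectively. **Proposition.** Let $d\ge 0$ be an integer, let $a_1,a_2\in\mathcal S_{1/2}'(\mathbf R^{2d})$ and let $A_1,A_2$ be real $d\times d$ matrices. Then $$\operatorname{Op}_{A_1}(a_1)=\operatorname{Op}_{A_2}(a_2)\quad\Longleftrightarrow\quad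 e^{i\langle A_2D_\xi,D_x\rangle}a_2=e^{i\langle A_1D_\xi,D_x\rangle}a_1 .$$ -/

import Mathlib

/-!
# Gelfand-Shilov spaces and matrix-parametrised pseudo-differential operators

The space `ℝ^n` is modelled as `ι → ℝ` with `ι` a finite index type, and `ℝ^m × ℝ^n` as
`ι ⊕ κ → ℝ`: the `Sum.inl` coordinates are the first variable and the `Sum.inr` coordinates the
second one. Only coordinates, Lebesgue measure and the dot product are used.
-/

set_option linter.unusedSectionVars false

noncomputable section

namespace GelfandShilov

open MeasureTheory
open scoped ContDiff Nat

section

variable {ι : Type*} [Fintype ι] [DecidableEq ι]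

/-- The partial derivative `∂_j f`. -/
def pderiv (j : ι) (f : (ι → ℝ) → ℂ) : (ι → ℝ) → ℂ :=
  fun x => fderiv ℝ f x (Pi.single j 1)

/-- The partial derivative `∂^α f`, where the multi-index `α` is given by the list of the
directions of differentiation: `α_j` is the number of occurrences of `j` in the list, and
`|α| = α.length`. Every multi-index arises from some list, and for smooth `f` the order of the
list is irrelevant. -/
def iterPderiv (α : List ι) (f : (ι → ℝ) → ℂ) : (ι → ℝ) → ℂ := α.foldr pderiv f

/-- The factorial `α! = ∏_j α_j!` of a multi-index. -/
def multiFactorial (α : ι → ℕ) : ℕ := ∏ j, (α j)!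

/-- The inequality `‖f‖_{S_{s,h}} ≤ C` for the norm
`‖f‖_{S_{s,h}} = sup |x^β ∂^α f(x)| / (h^{|α| + |β|} α!^s β!^s)`, the supremum being over all
multi-indices `α`, `β` and all points `x`. -/
def NormLE (s h C : ℝ) (f : (ι → ℝ) → ℂ) : Prop :=
  ∀ (α : List ι) (β : ι → ℕ) (x : ι → ℝ),
    |∏ j, x j ^ β j| * ‖iterPderiv α f x‖ ≤
      C * (h ^ (α.length + ∑ j, β j) *
        (multiFactorial fun j => α.count j : ℝ) ^ s * (multiFactorial β : ℝ) ^ s)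

lemma pderiv_add {f g : (ι → ℝ) → ℂ} (j : ι) (hf : ContDiff ℝ ∞ f) (hg : ContDiff ℝ ∞ g) :
    pderiv j (f + g) = pderiv j f + pderiv j g := by
  funext x
  simp only [pderiv, Pi.add_apply]
  rw [fderiv_add (hf.differentiable (by simp) x) (hg.differentiable (by simp) x)]
  rfl

lemma pderiv_smul {f : (ι → ℝ) → ℂ} (c : ℂ) (j : ι) (hf : ContDiff ℝ ∞ f) :
    pderiv j (c • f) = c • pderiv j f := by
  funext x
  simp only [pderiv, Pi.smul_apply]
  rw [fderiv_const_smul (hf.differentiable (by simp) x)]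
  rfl

lemma contDiff_pderiv {f : (ι → ℝ) → ℂ} (j : ι) (hf : ContDiff ℝ ∞ f) :
    ContDiff ℝ ∞ (pderiv j f) :=
  (hf.fderiv_right (m := ∞) (by simp)).clm_apply contDiff_const

lemma contDiff_iter {f : (ι → ℝ) → ℂ} (α : List ι) (hf : ContDiff ℝ ∞ f) :
    ContDiff ℝ ∞ (iterPderiv α f) := by
  induction α with
  | nil => exact hf
  | cons a l ih => exact contDiff_pderiv a ih

lemma iter_cons (a : ι) (l : List ι) (f : (ι → ℝ) → ℂ) :
    iterPderiv (a :: l) f = pderiv a (iterPderiv l f) := rfl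

lemma iter_append (l l' : List ι) (f : (ι → ℝ) → ℂ) :
    iterPderiv (l ++ l') f = iterPderiv l (iterPderiv l' f) := by
  simp [iterPderiv, List.foldr_append]

lemma iter_add {f g : (ι → ℝ) → ℂ} (α : List ι) (hf : ContDiff ℝ ∞ f) (hg : ContDiff ℝ ∞ g) :
    iterPderiv α (f + g) = iterPderiv α f + iterPderiv α g := by
  induction α with
  | nil => rfl
  | cons a l ih => rw [iter_cons, ih, pderiv_add a (contDiff_iter l hf) (contDiff_iter l hg)]; rfl

lemma iter_smul {f : (ι → ℝ) → ℂ} (c : ℂ) (α : List ι) (hf : ContDiff ℝ ∞ f) :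
    iterPderiv α (c • f) = c • iterPderiv α f := by
  induction α with
  | nil => rfl
  | cons a l ih => rw [iter_cons, ih, pderiv_smul c a (contDiff_iter l hf)]; rfl

lemma NormLE.nonneg {s h C : ℝ} {f : (ι → ℝ) → ℂ} (H : NormLE s h C f) : 0 ≤ C := by
  have := H [] 0 0
  simp [multiFactorial] at this
  exact (norm_nonneg _).trans this

lemma NormLE.mono {s h h' C : ℝ} {f : (ι → ℝ) → ℂ} (H : NormLE s h C f) (h0 : 0 ≤ h)
    (hh : h ≤ h') : NormLE s h' C f := fun α β x => by
  refine (H α β x).trans ?_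
  have := H.nonneg
  gcongr

lemma NormLE.add {s h C C' : ℝ} {f g : (ι → ℝ) → ℂ} (H : NormLE s h C f) (H' : NormLE s h C' g)
    (hf : ContDiff ℝ ∞ f) (hg : ContDiff ℝ ∞ g) : NormLE s h (C + C') (f + g) := fun α β x => by
  rw [iter_add α hf hg, add_mul]
  refine le_trans ?_ (add_le_add (H α β x) (H' α β x))
  rw [← mul_add]
  exact mul_le_mul_of_nonneg_left (norm_add_le _ _) (abs_nonneg _)

lemma NormLE.smul {s h C : ℝ} {f : (ι → ℝ) → ℂ} (c : ℂ) (H : NormLE s h C f)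
    (hf : ContDiff ℝ ∞ f) : NormLE s h (‖c‖ * C) (c • f) := fun α β x => by
  rw [iter_smul c α hf, mul_assoc]
  refine le_trans (le_of_eq ?_) (mul_le_mul_of_nonneg_left (H α β x) (norm_nonneg c))
  rw [Pi.smul_apply, norm_smul]; ring

/-- The Gelfand-Shilov space `S_s = ⋃_{h > 0} S_{s,h}`, where `S_{s,h}` is the set of smooth
functions with `‖f‖_{S_{s,h}} < ∞`. -/
def Space (s : ℝ) (ι : Type*) [Fintype ι] [DecidableEq ι] : Submodule ℂ ((ι → ℝ) → ℂ) where
  carrier := {f | ContDiff ℝ ∞ f ∧ ∃ h > 0, ∃ C, NormLE s h C f}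
  zero_mem' := ⟨contDiff_const, 1, one_pos, 0, fun α β x => by
    have : iterPderiv α (0 : (ι → ℝ) → ℂ) = 0 := by
      simpa using iter_smul (0 : ℂ) α (contDiff_const (c := (0 : ℂ)) : ContDiff ℝ ∞ fun _ : ι → ℝ => (0 : ℂ))
    simp [this]⟩
  add_mem' := by
    rintro f g ⟨hf, h, h0, C, H⟩ ⟨hg, h', h0', C', H'⟩
    exact ⟨hf.add hg, max h h', lt_max_of_lt_left h0, C + C',
      (H.mono h0.le (le_max_left _ _)).add (H'.mono h0'.le (le_max_right _ _)) hf hg⟩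
  smul_mem' := by
    rintro c f ⟨hf, h, h0, C, H⟩
    exact ⟨contDiff_const.smul hf, h, h0, ‖c‖ * C, H.smul c hf⟩

/-- The Gelfand-Shilov distribution space `S_s' = ⋂_{h > 0} S_{s,h}'`, the dual of `S_s`: the
linear functionals on `S_s` whose restriction to every Banach space `S_{s,h}` is bounded. These are
the functionals that are continuous for the inductive limit topology of `S_s`. -/
def Dual (s : ℝ) (ι : Type*) [Fintype ι] [DecidableEq ι] :
    Submodule ℂ (Space s ι →ₗ[ℂ] ℂ) where
  carrier := {u | ∀ h > 0, ∃ C : ℝ, ∀ (f : Space s ι) (M : ℝ),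
    NormLE s h M (f : (ι → ℝ) → ℂ) → ‖u f‖ ≤ C * M}
  zero_mem' := fun h _ => ⟨0, fun f M _ => by simp⟩
  add_mem' := by
    intro u v hu hv h h0
    obtain ⟨C, H⟩ := hu h h0
    obtain ⟨C', H'⟩ := hv h h0
    refine ⟨C + C', fun f M hM => ?_⟩
    rw [add_mul]
    exact (norm_add_le _ _).trans (add_le_add (H f M hM) (H' f M hM))
  smul_mem' := by
    intro c u hu h h0
    obtain ⟨C, H⟩ := hu h h0
    refine ⟨‖c‖ * C, fun f M hM => ?_⟩
    rw [mul_assoc, LinearMap.smul_apply, norm_smul]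
    exact mul_le_mul_of_nonneg_left (H f M hM) (norm_nonneg c)

end

section
variable {ι : Type*} [Fintype ι] [DecidableEq ι]

lemma multiFactorial_le (α : ι → ℕ) : multiFactorial α ≤ (∑ j, α j)! := by
  rw [← Nat.multinomial_spec]
  exact Nat.le_mul_of_pos_right _ (Nat.multinomial_pos _ _)

lemma factorial_sum_le_aux (s : Finset ι) (α : ι → ℕ) :
    (∑ j ∈ s, α j)! ≤ (2 ^ s.card) ^ (∑ j ∈ s, α j) * ∏ j ∈ s, (α j)! := by
  induction s using Finset.induction_on with
  | empty => simp
  | insert a s ha ih =>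
    rw [Finset.sum_insert ha, Finset.prod_insert ha, Finset.card_insert_of_notMem ha]
    set S := ∑ j ∈ s, α j
    calc (α a + S)! = (α a + S).choose (α a) * (α a)! * S ! := by
          have := Nat.choose_mul_factorial_mul_factorial (Nat.le_add_right (α a) S)
          rw [Nat.add_sub_cancel_left] at this
          exact this.symm
      _ ≤ 2 ^ (α a + S) * (α a)! * ((2 ^ s.card) ^ S * ∏ j ∈ s, (α j)!) := by
          gcongr
          exact Nat.choose_le_two_pow _ _
      _ ≤ 2 ^ (α a + S) * (α a)! * ((2 ^ s.card) ^ (α a + S) * ∏ j ∈ s, (α j)!) := by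
          gcongr
          · exact Nat.one_le_two_pow
          · omega
      _ = _ := by rw [pow_succ 2, mul_pow]; ring

lemma sum_count (α : List ι) : ∑ j, α.count j = α.length := by
  induction α with
  | nil => simp
  | cons a l ih => simp [List.count_cons, Finset.sum_add_distrib, ih]

/-- An auxiliary bound with a joint factorial, shifted by `N`. -/
def JB (N : ℕ) (h M : ℝ) (f : (ι → ℝ) → ℂ) : Prop :=
  ContDiff ℝ ∞ f ∧ ∀ (α : List ι) (β : ι → ℕ) (x : ι → ℝ),
    |∏ j, x j ^ β j| * ‖iterPderiv α f x‖ ≤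
      M * (h ^ (α.length + ∑ j, β j) * √((α.length + ∑ j, β j + N)! : ℝ))

lemma JB.nonneg {N : ℕ} {h M : ℝ} {f : (ι → ℝ) → ℂ} (H : JB N h M f) : 0 ≤ M := by
  have := H.2 [] 0 0
  simp at this
  have h2 : 0 < √(N ! : ℝ) := by positivity
  exact nonneg_of_mul_nonneg_left ((norm_nonneg _).trans this) h2

lemma JB.mono {N : ℕ} {h M M' : ℝ} {f : (ι → ℝ) → ℂ} (H : JB N h M f) (h0 : 0 ≤ h)
    (hM : M ≤ M') : JB N h M' f :=
  ⟨H.1, fun α β x => (H.2 α β x).trans (by gcongr)⟩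

lemma JB.mono_left {N N' : ℕ} {h h' M : ℝ} {f : (ι → ℝ) → ℂ} (H : JB N h M f) (h0 : 0 ≤ h)
    (hN : N ≤ N') (hh : h ≤ h') : JB N' h' M f :=
  ⟨H.1, fun α β x => (H.2 α β x).trans (by have := H.nonneg; have := h0.trans hh; gcongr)⟩

lemma NormLE.jb {h C : ℝ} {f : (ι → ℝ) → ℂ} (H : NormLE (1 / 2) h C f) (hf : ContDiff ℝ ∞ f)
    (h0 : 0 ≤ h) : JB 0 h C f := by
  refine ⟨hf, fun α β x => (H α β x).trans ?_⟩
  have := H.nonneg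
  rw [mul_assoc, ← Real.sqrt_eq_rpow, ← Real.sqrt_eq_rpow, ← Real.sqrt_mul (by positivity)]
  gcongr
  have h1 := multiFactorial_le (fun j => α.count j)
  rw [sum_count] at h1
  exact_mod_cast (Nat.mul_le_mul h1 (multiFactorial_le β)).trans
    (Nat.le_of_dvd (Nat.factorial_pos _) (Nat.factorial_mul_factorial_dvd_factorial_add _ _))

lemma factorial_add_le (m n : ℕ) : (m + n)! ≤ 2 ^ (m + n) * (m ! * n !) := by
  rw [← Nat.add_choose_mul_factorial_mul_factorial, mul_assoc]
  gcongr
  exact Nat.choose_le_two_pow _ _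

lemma JB.normLE {h M : ℝ} {f : (ι → ℝ) → ℂ} (H : JB 0 h M f) (h0 : 0 ≤ h) :
    NormLE (1 / 2) (2 * 2 ^ Fintype.card ι * h) M f := by
  intro α β x
  refine (H.2 α β x).trans ?_
  have hM := H.nonneg
  rw [mul_assoc (_ ^ _) (_ ^ _) (_ ^ _), ← Real.sqrt_eq_rpow, ← Real.sqrt_eq_rpow,
    ← Real.sqrt_mul (by positivity)]
  set m := α.length
  set n := ∑ j, β j
  have h1 := factorial_sum_le_aux Finset.univ (fun j => α.count j)
  have h2 := factorial_sum_le_aux Finset.univ β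
  rw [sum_count] at h1
  have h3 : (m + n + 0)! ≤ (2 * 2 ^ Fintype.card ι) ^ (m + n) *
      (multiFactorial (fun j => α.count j) * multiFactorial β) := by
    calc (m + n)! ≤ 2 ^ (m + n) * (m ! * n !) := factorial_add_le m n
      _ ≤ 2 ^ (m + n) * (((2 ^ Fintype.card ι) ^ m * multiFactorial (fun j => α.count j)) *
          ((2 ^ Fintype.card ι) ^ n * multiFactorial β)) := by
        gcongr
        · exact h1
        · exact h2
      _ = _ := by rw [mul_pow 2, pow_add (2 ^ Fintype.card ι)]; ring
  set K := 2 * 2 ^ Fintype.card ι with hK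
  have hK1 : 1 ≤ K := by rw [hK]; have := Nat.one_le_two_pow (n := Fintype.card ι); omega
  have h4 : √((m + n + 0)! : ℝ) ≤ (K : ℝ) ^ (m + n) *
      √((multiFactorial (fun j => α.count j) : ℝ) * multiFactorial β) := by
    rw [← Real.sqrt_sq (show (0 : ℝ) ≤ (K : ℝ) ^ (m + n) by positivity),
      ← Real.sqrt_mul (by positivity)]
    apply Real.sqrt_le_sqrt
    calc ((m + n + 0)! : ℝ) ≤ (K : ℝ) ^ (m + n) *
        ((multiFactorial (fun j => α.count j) : ℝ) * multiFactorial β) := by exact_mod_cast h3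
      _ ≤ _ := by
        gcongr
        exact le_self_pow₀ (one_le_pow₀ (by exact_mod_cast hK1)) two_ne_zero
  have hKc : (2 * 2 ^ Fintype.card ι * h : ℝ) = K * h := by rw [hK]; push_cast; ring
  rw [hKc, mul_pow]
  calc _ ≤ M * (h ^ (m + n) * ((K : ℝ) ^ (m + n) *
      √((multiFactorial (fun j => α.count j) : ℝ) * multiFactorial β))) := by gcongr
    _ = _ := by ring

lemma JB.zero {N : ℕ} {h : ℝ} : JB N h 0 (0 : (ι → ℝ) → ℂ) := by
  refine ⟨contDiff_const, fun α β x => ?_⟩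
  have : iterPderiv α (0 : (ι → ℝ) → ℂ) = 0 := by
    simpa using iter_smul (0 : ℂ) α
      (contDiff_const : ContDiff ℝ ∞ fun _ : ι → ℝ => (0 : ℂ))
  simp [this]

lemma JB.add {N : ℕ} {h M M' : ℝ} {f g : (ι → ℝ) → ℂ} (H : JB N h M f) (H' : JB N h M' g) :
    JB N h (M + M') (f + g) := by
  refine ⟨H.1.add H'.1, fun α β x => ?_⟩
  rw [iter_add α H.1 H'.1, add_mul]
  refine le_trans ?_ (add_le_add (H.2 α β x) (H'.2 α β x))
  rw [← mul_add]
  exact mul_le_mul_of_nonneg_left (norm_add_le _ _) (abs_nonneg _)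

lemma JB.smul {N : ℕ} {h M : ℝ} {f : (ι → ℝ) → ℂ} (c : ℂ) (H : JB N h M f) :
    JB N h (‖c‖ * M) (c • f) := by
  refine ⟨contDiff_const.smul H.1, fun α β x => ?_⟩
  rw [iter_smul c α H.1, mul_assoc]
  refine le_trans (le_of_eq ?_) (mul_le_mul_of_nonneg_left (H.2 α β x) (norm_nonneg c))
  rw [Pi.smul_apply, norm_smul]; ring

lemma JB.sum {κ : Type*} (s : Finset κ) {N : ℕ} {h : ℝ} {M : κ → ℝ} {f : κ → (ι → ℝ) → ℂ}
    (H : ∀ k, JB N h (M k) (f k)) : JB N h (∑ k ∈ s, M k) (∑ k ∈ s, f k) := by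
  classical
  induction s using Finset.induction_on with
  | empty => simpa using JB.zero
  | insert a s ha ih =>
    rw [Finset.sum_insert ha, Finset.sum_insert ha]
    exact (H a).add ih

/-- Multiplication by the coordinate `x_j`. -/
def mulX (j : ι) (f : (ι → ℝ) → ℂ) : (ι → ℝ) → ℂ := fun x => (x j : ℂ) * f x

lemma contDiff_coord (j : ι) : ContDiff ℝ ∞ fun x : ι → ℝ => (x j : ℂ) :=
  Complex.ofRealCLM.contDiff.comp (contDiff_apply ℝ ℝ j)

lemma contDiff_mulX (j : ι) {f : (ι → ℝ) → ℂ} (hf : ContDiff ℝ ∞ f) :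
    ContDiff ℝ ∞ (mulX j f) := (contDiff_coord j).mul hf

lemma pderiv_mulX (i j : ι) {f : (ι → ℝ) → ℂ} (hf : ContDiff ℝ ∞ f) :
    pderiv i (mulX j f) = mulX j (pderiv i f) + if i = j then f else 0 := by
  funext x
  have h1 : HasFDerivAt (fun x : ι → ℝ => (x j : ℂ))
      (Complex.ofRealCLM.comp (ContinuousLinearMap.proj j : (ι → ℝ) →L[ℝ] ℝ)) x :=
    (Complex.ofRealCLM.comp (ContinuousLinearMap.proj j : (ι → ℝ) →L[ℝ] ℝ)).hasFDerivAt
  have h2 := h1.mul (hf.differentiable (by simp) x).hasFDerivAt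
  have h3 : fderiv ℝ (mulX j f) x = _ := h2.fderiv
  simp only [pderiv, h3, mulX, Pi.add_apply]
  by_cases hij : i = j
  · subst hij; simp
  · simp [hij, Ne.symm hij]

/-- The derivatives appearing in the commutator of `∂^α` and `x_j`. -/
def rem (j : ι) : List ι → List (List ι)
  | [] => []
  | a :: l => (if a = j then [l] else []) ++ (rem j l).map (List.cons a)

lemma rem_length (j : ι) (l : List ι) : (rem j l).length ≤ l.length := by
  induction l with
  | nil => simp [rem]
  | cons a l ih => simp only [rem]; split_ifs <;> simp <;> omega

lemma rem_mem (j : ι) (l l' : List ι) (h : l' ∈ rem j l) : l'.length + 1 = l.length := by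
  induction l generalizing l' with
  | nil => simp [rem] at h
  | cons a l ih =>
    simp only [rem, List.mem_append, List.mem_map] at h
    rcases h with h | ⟨l2, h2, rfl⟩
    · split_ifs at h <;> simp_all
    · simp [ih l2 h2]

lemma contDiff_listSum {f : (ι → ℝ) → ℂ} (hf : ContDiff ℝ ∞ f) (L : List (List ι)) :
    ContDiff ℝ ∞ (L.map fun l => iterPderiv l f).sum := by
  induction L with
  | nil => exact contDiff_const
  | cons a L ih => rw [List.map_cons, List.sum_cons]; exact (contDiff_iter a hf).add ih

lemma pderiv_listSum {f : (ι → ℝ) → ℂ} (hf : ContDiff ℝ ∞ f) (a : ι) (L : List (List ι)) :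
    pderiv a (L.map fun l => iterPderiv l f).sum =
      ((L.map (List.cons a)).map fun l => iterPderiv l f).sum := by
  induction L with
  | nil => funext x; simp [pderiv]
  | cons b L ih =>
    simp only [List.map_cons, List.sum_cons]
    rw [pderiv_add a (contDiff_iter b hf) (contDiff_listSum hf L), ih]
    rfl

lemma iter_mulX (j : ι) {f : (ι → ℝ) → ℂ} (hf : ContDiff ℝ ∞ f) (l : List ι) :
    iterPderiv l (mulX j f) = mulX j (iterPderiv l f) +
      ((rem j l).map fun l' => iterPderiv l' f).sum := by
  induction l with
  | nil => simp [iterPderiv, rem]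
  | cons a l ih =>
    rw [iter_cons, ih, pderiv_add a (contDiff_mulX j (contDiff_iter l hf)) (contDiff_listSum hf _),
      pderiv_mulX a j (contDiff_iter l hf), pderiv_listSum hf, ← iter_cons, rem]
    by_cases h : a = j
    · simp [h, add_assoc]
    · simp [h]

lemma JB.pderiv {N : ℕ} {h M : ℝ} {f : (ι → ℝ) → ℂ} (j : ι) (H : JB N h M f) :
    JB (N + 1) h (h * M) (pderiv j f) := by
  refine ⟨contDiff_pderiv j H.1, fun α β x => ?_⟩
  have := H.2 (α ++ [j]) β x
  rw [iter_append] at this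
  refine this.trans (le_of_eq ?_)
  rw [List.length_append, List.length_singleton,
    show α.length + 1 + ∑ j, β j = α.length + ∑ j, β j + 1 by ring, pow_succ,
    show α.length + ∑ j, β j + 1 + N = α.length + ∑ j, β j + (N + 1) by ring]
  ring

lemma prod_pow_add_single (β : ι → ℕ) (j : ι) (x : ι → ℝ) :
    ∏ i, x i ^ (β + Pi.single j 1 : ι → ℕ) i = (∏ i, x i ^ β i) * x j := by
  simp only [Pi.add_apply, pow_add, Finset.prod_mul_distrib]
  congr 1
  rw [Finset.prod_eq_single j] <;> simp +contextual

lemma sum_add_single (β : ι → ℕ) (j : ι) :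
    ∑ i, (β + Pi.single j 1 : ι → ℕ) i = ∑ i, β i + 1 := by
  simp [Finset.sum_add_distrib]

lemma norm_listSum_le (L : List (List ι)) (f : (ι → ℝ) → ℂ) (x : ι → ℝ) (P B : ℝ) (hP : 0 ≤ P)
    (h : ∀ l ∈ L, P * ‖iterPderiv l f x‖ ≤ B) :
    P * ‖(L.map fun l' => iterPderiv l' f).sum x‖ ≤ L.length * B := by
  induction L with
  | nil => simp
  | cons a L ih =>
    simp only [List.map_cons, List.sum_cons, Pi.add_apply, List.length_cons]
    have h1 := ih fun l hl => h l (by simp [hl])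
    have h2 := h a (by simp)
    have h3 := mul_le_mul_of_nonneg_left
      (norm_add_le (iterPderiv a f x) ((L.map fun l' => iterPderiv l' f).sum x)) hP
    push_cast
    linarith

lemma JB.mulX {N : ℕ} {h M : ℝ} {f : (ι → ℝ) → ℂ} (j : ι) (h1 : 1 ≤ h) (H : JB N h M f) :
    JB (N + 1) h ((h + 1) * M) (mulX j f) := by
  refine ⟨contDiff_mulX j H.1, fun α β x => ?_⟩
  have hM := H.nonneg
  rw [iter_mulX j H.1, Pi.add_apply]
  set P := |∏ i, x i ^ β i|
  have hP : 0 ≤ P := abs_nonneg _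
  set n := ∑ i, β i with hn
  have e1 : P * ‖GelfandShilov.mulX j (iterPderiv α f) x‖ ≤
      M * (h ^ (α.length + n + 1) * √((α.length + n + (N + 1))! : ℝ)) := by
    have := H.2 α (β + Pi.single j 1 : ι → ℕ) x
    rw [prod_pow_add_single, sum_add_single, abs_mul] at this
    rw [GelfandShilov.mulX, norm_mul, Complex.norm_real, Real.norm_eq_abs, ← mul_assoc]
    refine this.trans (le_of_eq ?_)
    rw [show α.length + (∑ i, β i + 1) + N = α.length + n + (N + 1) by rw [hn]; ring]
    rfl
  have e2 : P * ‖((rem j α).map fun l' => iterPderiv l' f).sum x‖ ≤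
      M * (h ^ (α.length + n) * √((α.length + n + (N + 1))! : ℝ)) := by
    rcases Nat.eq_zero_or_pos α.length with h0 | h0
    · have : α = [] := List.length_eq_zero_iff.1 h0
      subst this
      simp only [rem, List.map_nil, List.sum_nil, Pi.zero_apply, norm_zero, mul_zero]
      positivity
    have := norm_listSum_le (rem j α) f x P
      (M * (h ^ (α.length - 1 + n) * √((α.length - 1 + n + N)! : ℝ))) hP (fun l hl => by
        have h2 := H.2 l β x
        rwa [show l.length = α.length - 1 by have := rem_mem j α l hl; omega] at h2)
    refine this.trans ?_
    have hl : ((rem j α).length : ℝ) ≤ α.length := by exact_mod_cast rem_length j α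
    obtain ⟨k, hk⟩ : ∃ k, α.length = k + 1 := ⟨α.length - 1, by omega⟩
    rw [hk] at hl ⊢
    simp only [Nat.add_sub_cancel]
    have hs : ((k + 1 : ℕ) : ℝ) * √((k + n + N)! : ℝ) ≤ √((k + 1 + n + (N + 1))! : ℝ) := by
      rw [← Real.sqrt_sq (show (0 : ℝ) ≤ ((k + 1 : ℕ) : ℝ) by positivity),
        ← Real.sqrt_mul (by positivity)]
      apply Real.sqrt_le_sqrt
      rw [show k + 1 + n + (N + 1) = (k + n + N) + 1 + 1 by ring]
      have : (k + 1) ^ 2 * (k + n + N)! ≤ ((k + n + N) + 1 + 1)! := by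
        rw [Nat.factorial_succ, Nat.factorial_succ, ← mul_assoc, sq]
        gcongr <;> omega
      exact_mod_cast this
    calc ((rem j α).length : ℝ) * (M * (h ^ (k + n) * √((k + n + N)! : ℝ)))
        ≤ ((k + 1 : ℕ) : ℝ) * (M * (h ^ (k + n) * √((k + n + N)! : ℝ))) := by gcongr
      _ = M * (h ^ (k + n) * (((k + 1 : ℕ) : ℝ) * √((k + n + N)! : ℝ))) := by ring
      _ ≤ M * (h ^ (k + 1 + n) * √((k + 1 + n + (N + 1))! : ℝ)) := by
          gcongr
          · omega
  calc _ ≤ P * ‖GelfandShilov.mulX j (iterPderiv α f) x‖ +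
        P * ‖((rem j α).map fun l' => iterPderiv l' f).sum x‖ := by
        rw [← mul_add]
        exact mul_le_mul_of_nonneg_left (norm_add_le _ _) hP
    _ ≤ _ := add_le_add e1 e2
    _ = _ := by rw [pow_succ]; ring

/-- A first order operator with linear coefficients. -/
def lin (c d : ι → ℂ) (f : (ι → ℝ) → ℂ) : (ι → ℝ) → ℂ :=
  ∑ i, (c i • mulX i f + d i • pderiv i f)

lemma JB.lin {N : ℕ} {h M R : ℝ} {f : (ι → ℝ) → ℂ} (c d : ι → ℂ) (h1 : 1 ≤ h) (H : JB N h M f)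
    (hR : ∑ i, (‖c i‖ + ‖d i‖) ≤ R) : JB (N + 1) h (R * (h + 1) * M) (lin c d f) := by
  have := JB.sum Finset.univ (fun i => ((H.mulX i h1).smul (c i)).add ((H.pderiv i).smul (d i)))
  refine this.mono (by linarith) ?_
  have hM := H.nonneg
  calc _ ≤ ∑ i, (‖c i‖ + ‖d i‖) * ((h + 1) * M) := by
        apply Finset.sum_le_sum; intro i _
        have h5 : ‖c i‖ * ((h + 1) * M) + ‖d i‖ * (h * M) ≤
            ‖c i‖ * ((h + 1) * M) + ‖d i‖ * ((h + 1) * M) := by gcongr; linarith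
        linarith
    _ = (∑ i, (‖c i‖ + ‖d i‖)) * ((h + 1) * M) := by rw [Finset.sum_mul]
    _ ≤ R * ((h + 1) * M) := by gcongr
    _ = _ := by ring

/-- Functions satisfying some bound. -/
def Nice (f : (ι → ℝ) → ℂ) : Prop := ∃ N h M, 1 ≤ h ∧ JB N h M f

lemma Nice.lin {f : (ι → ℝ) → ℂ} (H : Nice f) (c d : ι → ℂ) : Nice (lin c d f) := by
  obtain ⟨N, h, M, h1, H⟩ := H
  exact ⟨N + 1, h, _, h1, H.lin c d h1 le_rfl⟩

end

section
variable {ι κ : Type*} [Fintype ι] [DecidableEq ι] [Fintype κ] [DecidableEq κ]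

/-- Operators that conjugate first order operators into such operators preserve the bounds. -/
structure Transfers (T : ((ι → ℝ) → ℂ) → (κ → ℝ) → ℂ) : Prop where
  diff : ∀ g, Nice g → Differentiable ℝ (T g)
  bound : ∃ p : ℕ, ∀ h, 1 ≤ h → ∃ K : ℝ, 0 ≤ K ∧ ∀ N M g, JB N h M g → ∀ x,
    ‖T g x‖ ≤ K * M * √((N + p)! : ℝ)
  pderiv : ∀ j, ∃ c d : ι → ℂ, ∀ g, Nice g → pderiv j (T g) = T (lin c d g)
  mulX : ∀ j, ∃ c d : ι → ℂ, ∀ g, Nice g → mulX j (T g) = T (lin c d g)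

lemma contDiff_of_pderiv_nat (𝒯 : Set ((κ → ℝ) → ℂ)) (hd : ∀ g ∈ 𝒯, Differentiable ℝ g)
    (hp : ∀ g ∈ 𝒯, ∀ j, pderiv j g ∈ 𝒯) (n : ℕ) : ∀ g ∈ 𝒯, ContDiff ℝ n g := by
  induction n with
  | zero => intro g hg; exact contDiff_zero.2 (hd g hg).continuous
  | succ n ih =>
    intro g hg
    have : fderiv ℝ g = fun x => ∑ j, (ContinuousLinearMap.proj j :
        (κ → ℝ) →L[ℝ] ℝ).smulRight (GelfandShilov.pderiv j g x) := by
      funext x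
      ext v
      conv_lhs => rw [pi_eq_sum_univ' v]
      simp only [map_sum, map_smul, _root_.sum_apply]
      apply Finset.sum_congr rfl
      intro i _
      simp only [ContinuousLinearMap.smulRight_apply, ContinuousLinearMap.proj_apply,
        GelfandShilov.pderiv]
    rw [Nat.cast_succ, contDiff_succ_iff_fderiv]
    refine ⟨hd g hg, by simp, ?_⟩
    rw [this]
    apply ContDiff.sum
    intro j _
    exact ContDiff.smulRight contDiff_const (ih _ (hp g hg j))

lemma Transfers.contDiff {T : ((ι → ℝ) → ℂ) → (κ → ℝ) → ℂ} (hT : Transfers T)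
    {g : (ι → ℝ) → ℂ} (hg : Nice g) : ContDiff ℝ ∞ (T g) := by
  rw [contDiff_infty]
  intro n
  refine contDiff_of_pderiv_nat {u | ∃ g, Nice g ∧ u = T g} ?_ ?_ n _ ⟨g, hg, rfl⟩
  · rintro _ ⟨g, hg, rfl⟩; exact hT.diff g hg
  · rintro _ ⟨g, hg, rfl⟩ j
    obtain ⟨c, d, H⟩ := hT.pderiv j
    exact ⟨_, hg.lin c d, H g hg⟩

lemma Transfers.jb {T : ((ι → ℝ) → ℂ) → (κ → ℝ) → ℂ} (hT : Transfers T) (h : ℝ) (h1 : 1 ≤ h) :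
    ∃ h' ≥ (1 : ℝ), ∃ C ≥ (0 : ℝ), ∀ f M, JB 0 h M f → JB 0 h' (C * M) (T f) := by
  choose cP dP HP using hT.pderiv
  choose cX dX HX using hT.mulX
  obtain ⟨p, hp⟩ := hT.bound
  obtain ⟨K, hK0, hK⟩ := hp h h1
  set R : ℝ := 1 + ∑ j, ∑ i, (‖cP j i‖ + ‖dP j i‖) + ∑ j, ∑ i, (‖cX j i‖ + ‖dX j i‖) with hR
  have hP0 : 0 ≤ ∑ j, ∑ i, (‖cP j i‖ + ‖dP j i‖) := by positivity
  have hX0 : 0 ≤ ∑ j, ∑ i, (‖cX j i‖ + ‖dX j i‖) := by positivity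
  have hRP : ∀ j, ∑ i, (‖cP j i‖ + ‖dP j i‖) ≤ R := fun j => by
    have := Finset.single_le_sum (f := fun j => ∑ i, (‖cP j i‖ + ‖dP j i‖))
      (fun j _ => by positivity) (Finset.mem_univ j)
    linarith
  have hRX : ∀ j, ∑ i, (‖cX j i‖ + ‖dX j i‖) ≤ R := fun j => by
    have := Finset.single_le_sum (f := fun j => ∑ i, (‖cX j i‖ + ‖dX j i‖))
      (fun j _ => by positivity) (Finset.mem_univ j)
    linarith
  have hR1 : 1 ≤ R := by linarith
  set Q := R * (h + 1) with hQ
  have hQ1 : 1 ≤ Q := by nlinarith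
  have key1 : ∀ f M, JB 0 h M f → ∀ l : List κ, ∃ g, JB l.length h (Q ^ l.length * M) g ∧
      iterPderiv l (T f) = T g := by
    intro f M H l
    induction l with
    | nil => exact ⟨f, by simpa using H, rfl⟩
    | cons a l ih =>
      obtain ⟨g, hg, e⟩ := ih
      refine ⟨GelfandShilov.lin (cP a) (dP a) g, ?_, ?_⟩
      · have := hg.lin (cP a) (dP a) h1 (hRP a)
        rw [List.length_cons, pow_succ']
        convert this using 1
        rw [hQ]; ring
      · rw [iter_cons, e, HP a g ⟨_, _, _, h1, hg⟩]
  have key2 : ∀ n (β : κ → ℕ), ∑ j, β j = n → ∀ N M g, JB N h M g →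
      ∃ g', JB (N + n) h (Q ^ n * M) g' ∧
        ∀ x, ((∏ j, x j ^ β j : ℝ) : ℂ) * T g x = T g' x := by
    intro n
    induction n with
    | zero =>
      intro β hβ N M g hg
      have : ∀ j, β j = 0 := by simpa using hβ
      exact ⟨g, by simpa using hg, fun x => by simp [this]⟩
    | succ n ih =>
      intro β hβ N M g hg
      obtain ⟨j, hj⟩ : ∃ j, β j ≠ 0 := by
        by_contra hcon
        push Not at hcon
        simp [hcon] at hβ
      set β' : κ → ℕ := β - Pi.single j 1 with hβ'
      have e : β = β' + Pi.single j 1 := by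
        funext i
        simp only [hβ', Pi.add_apply, Pi.sub_apply]
        by_cases hij : i = j
        · subst hij; simp; omega
        · simp [hij]
      have hs : ∑ j, β' j = n := by
        rw [e, sum_add_single] at hβ; omega
      have hg1 := hg.lin (cX j) (dX j) h1 (hRX j)
      obtain ⟨g', hg', e'⟩ := ih β' hs _ _ _ hg1
      refine ⟨g', ?_, fun x => ?_⟩
      · convert hg' using 1
        · ring
        · rw [pow_succ, hQ]; ring
      · rw [e, prod_pow_add_single, ← e', ← HX j g ⟨_, _, _, h1, hg⟩]
        simp only [GelfandShilov.mulX]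
        push_cast; ring
  refine ⟨2 * Q, by linarith, K * √((2 ^ p * p ! : ℕ) : ℝ), by positivity, fun f M H =>
    ⟨hT.contDiff ⟨_, _, _, h1, H⟩, fun α β x => ?_⟩⟩
  obtain ⟨g, hg, e⟩ := key1 f M H α
  obtain ⟨g', hg', e'⟩ := key2 _ β rfl _ _ g hg
  have hM := H.nonneg
  have hb := hK _ _ g' hg' x
  rw [← e', ← e, norm_mul, Complex.norm_real, Real.norm_eq_abs] at hb
  refine hb.trans ?_
  set m := α.length + ∑ j, β j
  have hf : √((m + p)! : ℝ) ≤ 2 ^ m * √((2 ^ p * p ! : ℕ) : ℝ) * √(m ! : ℝ) := by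
    rw [← Real.sqrt_sq (show (0 : ℝ) ≤ 2 ^ m by positivity),
      ← Real.sqrt_mul (by positivity), ← Real.sqrt_mul (by positivity)]
    apply Real.sqrt_le_sqrt
    have h5 : (m + p)! ≤ (2 ^ m) ^ 2 * (2 ^ p * p !) * m ! := by
      refine (factorial_add_le m p).trans ?_
      rw [pow_add]
      have : 2 ^ m ≤ (2 ^ m) ^ 2 := Nat.le_self_pow two_ne_zero _
      calc 2 ^ m * 2 ^ p * (m ! * p !) ≤ (2 ^ m) ^ 2 * 2 ^ p * (m ! * p !) := by gcongr
        _ = _ := by ring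
    exact_mod_cast h5
  calc _ ≤ K * (Q ^ (∑ j, β j) * (Q ^ α.length * M)) *
        (2 ^ m * √((2 ^ p * p ! : ℕ) : ℝ) * √(m ! : ℝ)) := by
        gcongr
    _ = _ := by
      rw [mul_pow 2, add_zero, show Q ^ m = Q ^ α.length * Q ^ (∑ j, β j) from pow_add _ _ _]
      ring

/-- A linear map between the spaces `S_{1/2}` that is bounded from every `S_{1/2,h}` to some
`S_{1/2,h'}`. -/
def IsContinuous (T : Space (1 / 2) ι →ₗ[ℂ] Space (1 / 2) κ) : Prop :=
  ∀ h > 0, ∃ h' > 0, ∃ C : ℝ, ∀ (f : Space (1 / 2) ι) (M : ℝ),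
    NormLE (1 / 2) h M (f : (ι → ℝ) → ℂ) → NormLE (1 / 2) h' (C * M) (T f : (κ → ℝ) → ℂ)

lemma Transfers.normLE {T : ((ι → ℝ) → ℂ) → (κ → ℝ) → ℂ} (hT : Transfers T) (h : ℝ) :
    ∃ h' > (0 : ℝ), ∃ C : ℝ, ∀ f M, ContDiff ℝ ∞ f → NormLE (1 / 2) h M f → 0 ≤ h →
      NormLE (1 / 2) h' (C * M) (T f) := by
  obtain ⟨h', h1', C, hC, H⟩ := hT.jb (max 1 h) (le_max_left _ _)
  refine ⟨2 * 2 ^ Fintype.card κ * h', by positivity, C, fun f M hf hM h0 => ?_⟩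
  exact (H f M ((hM.mono h0 (le_max_right _ _)).jb hf (by positivity))).normLE (by linarith)

lemma nice_of_mem {f : (ι → ℝ) → ℂ} (hf : f ∈ Space (1 / 2) ι) : Nice f := by
  obtain ⟨hc, h, h0, C, H⟩ := hf
  exact ⟨0, max 1 h, C, le_max_left _ _, (H.mono h0.le (le_max_right _ _)).jb hc (by positivity)⟩

lemma Transfers.mem {T : ((ι → ℝ) → ℂ) → (κ → ℝ) → ℂ} (hT : Transfers T) {f : (ι → ℝ) → ℂ}
    (hf : f ∈ Space (1 / 2) ι) : T f ∈ Space (1 / 2) κ := by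
  refine ⟨hT.contDiff (nice_of_mem hf), ?_⟩
  obtain ⟨hc, h, h0, C, H⟩ := hf
  obtain ⟨h', h0', C', H'⟩ := hT.normLE h
  exact ⟨h', h0', C' * C, H' f C hc H h0.le⟩
end

section
variable {ι κ : Type*} [Fintype ι] [DecidableEq ι] [Fintype κ] [DecidableEq κ]

lemma fderiv_eq_sum (g : (κ → ℝ) → ℂ) (x v : κ → ℝ) :
    fderiv ℝ g x v = ∑ j, (v j : ℂ) * pderiv j g x := by
  conv_lhs => rw [pi_eq_sum_univ' v]
  simp [map_sum, map_smul, pderiv]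

lemma lin_apply (c d : ι → ℂ) (f : (ι → ℝ) → ℂ) (x : ι → ℝ) :
    lin c d f x = ∑ i, (c i * ((x i : ℂ) * f x) + d i * pderiv i f x) := by
  simp [lin, mulX, Finset.sum_apply]

lemma lin_zero_single (j : ι) (c : ℂ) (f : (ι → ℝ) → ℂ) :
    lin 0 (Pi.single j c) f = c • pderiv j f := by
  funext x
  rw [lin_apply, Finset.sum_eq_single j] <;> simp +contextual

lemma lin_single_zero (j : ι) (c : ℂ) (f : (ι → ℝ) → ℂ) :
    lin (Pi.single j c) 0 f = c • mulX j f := by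
  funext x
  rw [lin_apply, Finset.sum_eq_single j] <;> simp +contextual [mulX]

lemma Nice.contDiff {f : (ι → ℝ) → ℂ} (H : Nice f) : ContDiff ℝ ∞ f := by
  obtain ⟨_, _, _, _, H⟩ := H; exact H.1

lemma Nice.differentiable {f : (ι → ℝ) → ℂ} (H : Nice f) : Differentiable ℝ f :=
  H.contDiff.differentiable (by simp)

lemma JB.norm_le {N : ℕ} {h M : ℝ} {f : (ι → ℝ) → ℂ} (H : JB N h M f) (x : ι → ℝ) :
    ‖f x‖ ≤ M * √(N ! : ℝ) := by
  simpa [iterPderiv] using H.2 [] 0 x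

lemma hasFDerivAt_coord (j : ι) (w : ι → ℝ) : HasFDerivAt (fun w : ι → ℝ => w j)
    (ContinuousLinearMap.proj j : (ι → ℝ) →L[ℝ] ℝ) w :=
  (ContinuousLinearMap.proj j : (ι → ℝ) →L[ℝ] ℝ).hasFDerivAt

lemma hasFDerivAt_restrict (e : κ → ι) (w : ι → ℝ) :
    HasFDerivAt (fun w : ι → ℝ => fun a => w (e a)) (ContinuousLinearMap.pi fun a : κ =>
      (ContinuousLinearMap.proj (e a) : (ι → ℝ) →L[ℝ] ℝ)) w :=
  hasFDerivAt_pi.2 fun a => hasFDerivAt_coord (e a) w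

/-! ### Linear changes of variables -/

lemma transfers_comp (L : (κ → ℝ) ≃ₗ[ℝ] (ι → ℝ)) :
    Transfers (fun f : (ι → ℝ) → ℂ => f ∘ L) where
  diff g hg := hg.differentiable.comp (LinearMap.toContinuousLinearMap L.toLinearMap).differentiable
  bound := ⟨0, fun h _ => ⟨1, zero_le_one, fun N M g hg x => by
    simpa using hg.norm_le (L x)⟩⟩
  pderiv j := by
    refine ⟨0, fun i => (L (Pi.single j 1) i : ℂ), fun g hg => ?_⟩
    funext x
    have h1 : HasFDerivAt (g ∘ L) _ x := (hg.differentiable (L x)).hasFDerivAt.comp x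
      (LinearMap.toContinuousLinearMap L.toLinearMap).hasFDerivAt
    simp only [GelfandShilov.pderiv, h1.fderiv, ContinuousLinearMap.comp_apply,
      Function.comp_apply, lin_apply]
    exact (fderiv_eq_sum g (L x) (L (Pi.single j 1))).trans (by simp [GelfandShilov.pderiv])
  mulX j := by
    refine ⟨fun i => (L.symm (Pi.single i 1) j : ℂ), 0, fun g hg => ?_⟩
    funext x
    have h1 : x j = ∑ i, L.symm (Pi.single i 1) j * L x i := by
      conv_lhs => rw [← L.symm_apply_apply x, pi_eq_sum_univ' (L x)]
      simp [map_sum, map_smul, Finset.sum_apply, mul_comm]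
    simp only [GelfandShilov.mulX, Function.comp_apply, lin_apply]
    rw [h1]
    push_cast
    rw [Finset.sum_mul]
    apply Finset.sum_congr rfl
    intro i _
    simp [mul_assoc]

/-! ### Multiplication by a chirp -/

/-- The function `(x, y) ↦ e^{i⟨Ay, x⟩} f(x, y)`. -/
def chirpFun (A : Matrix ι κ ℝ) (f : (ι ⊕ κ → ℝ) → ℂ) : (ι ⊕ κ → ℝ) → ℂ := fun w =>
  Complex.exp (Complex.I * ((A.mulVec (fun b => w (.inr b)) ⬝ᵥ fun a => w (.inl a) : ℝ) : ℂ)) * f w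

/-- The coefficients of the derivative of the phase of a chirp. -/
def chirpDeriv (A : Matrix ι κ ℝ) : ι ⊕ κ → ι ⊕ κ → ℂ
  | .inl a => Sum.elim 0 (fun b => Complex.I * A a b)
  | .inr b => Sum.elim (fun a => Complex.I * A a b) 0

lemma transfers_chirp (A : Matrix ι κ ℝ) : Transfers (chirpFun A) where
  diff g hg := by
    have := hg.differentiable
    unfold chirpFun Matrix.mulVec dotProduct
    fun_prop
  bound := ⟨0, fun h _ => ⟨1, zero_le_one, fun N M g hg x => by
    have := hg.norm_le x
    rw [chirpFun, norm_mul, mul_comm Complex.I, Complex.norm_exp_ofReal_mul_I]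
    simpa using this⟩⟩
  pderiv j := by
    refine ⟨chirpDeriv A j, Pi.single j 1, fun g hg => ?_⟩
    funext w
    have h0 : HasFDerivAt (fun w : ι ⊕ κ → ℝ =>
        ((A.mulVec (fun b => w (.inr b)) ⬝ᵥ fun a => w (.inl a) : ℝ)))
        (∑ a, ((∑ b, A a b * w (.inr b)) •
          (ContinuousLinearMap.proj (.inl a) : (ι ⊕ κ → ℝ) →L[ℝ] ℝ) +
          w (.inl a) • ∑ b, A a b •
            (ContinuousLinearMap.proj (.inr b) : (ι ⊕ κ → ℝ) →L[ℝ] ℝ))) w := by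
      unfold Matrix.mulVec dotProduct
      apply HasFDerivAt.fun_sum
      intro a _
      refine HasFDerivAt.mul ?_ (hasFDerivAt_coord _ w)
      apply HasFDerivAt.fun_sum
      intro b _
      exact (ContinuousLinearMap.hasFDerivAt
        (ContinuousLinearMap.proj (.inr b) : (ι ⊕ κ → ℝ) →L[ℝ] ℝ)).const_mul _
    have h1 := ((Complex.ofRealCLM.hasFDerivAt.comp w h0).const_mul Complex.I).cexp
    have h2 : HasFDerivAt (chirpFun A g) _ w := h1.mul (hg.differentiable w).hasFDerivAt
    simp only [GelfandShilov.pderiv, h2.fderiv]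
    cases j <;> simp [_root_.sum_apply, Pi.single_apply, lin_apply, chirpDeriv, GelfandShilov.pderiv, chirpFun]
    · rename_i a
      have : ∑ b, Complex.I * (A a b : ℂ) * ((w (.inr b) : ℂ) * g w) =
          Complex.I * (∑ b, (A a b : ℂ) * (w (.inr b) : ℂ)) * g w := by
        rw [Finset.mul_sum, Finset.sum_mul]
        exact Finset.sum_congr rfl fun b _ => by ring
      rw [this]; ring
    · rename_i b
      have : ∑ a, Complex.I * (A a b : ℂ) * ((w (.inl a) : ℂ) * g w) =
          Complex.I * (∑ a, (w (.inl a) : ℂ) * (A a b : ℂ)) * g w := by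
        rw [Finset.mul_sum, Finset.sum_mul]
        exact Finset.sum_congr rfl fun a _ => by ring
      rw [this]; ring
  mulX j := by
    refine ⟨Pi.single j 1, 0, fun g hg => ?_⟩
    rw [lin_single_zero]
    funext w
    simp only [GelfandShilov.mulX, chirpFun, Pi.smul_apply, smul_eq_mul]
    ring

/-! ### Tensor products -/

/-- The tensor product `(g ⊗ f)(x, y) = g(x) f(y)`. -/
def tensorFun (g : (ι → ℝ) → ℂ) (f : (κ → ℝ) → ℂ) : (ι ⊕ κ → ℝ) → ℂ :=
  fun w => g (fun a => w (.inl a)) * f (fun b => w (.inr b))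

lemma contDiff_tensor {g : (ι → ℝ) → ℂ} {f : (κ → ℝ) → ℂ} (hg : ContDiff ℝ ∞ g)
    (hf : ContDiff ℝ ∞ f) : ContDiff ℝ ∞ (tensorFun g f) :=
  (hg.comp (contDiff_pi.2 fun a => contDiff_apply ℝ ℝ (Sum.inl a))).mul
    (hf.comp (contDiff_pi.2 fun b => contDiff_apply ℝ ℝ (Sum.inr b)))

lemma iter_tensor {g : (ι → ℝ) → ℂ} {f : (κ → ℝ) → ℂ} (hg : ContDiff ℝ ∞ g)
    (hf : ContDiff ℝ ∞ f) (α : List (ι ⊕ κ)) :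
    iterPderiv α (tensorFun g f) = tensorFun (iterPderiv (α.filterMap Sum.getLeft?) g)
      (iterPderiv (α.filterMap Sum.getRight?) f) := by
  induction α with
  | nil => rfl
  | cons a l ih =>
    rw [iter_cons, ih]
    have hg1 := contDiff_iter (l.filterMap Sum.getLeft?) hg
    have hf1 := contDiff_iter (l.filterMap Sum.getRight?) hf
    generalize hg2 : iterPderiv (l.filterMap Sum.getLeft?) g = g1 at *
    generalize hf2 : iterPderiv (l.filterMap Sum.getRight?) f = f1 at *
    funext w
    have e1 : HasFDerivAt (fun w : ι ⊕ κ → ℝ => fun a => w (.inl a))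
        (ContinuousLinearMap.pi fun a : ι =>
          (ContinuousLinearMap.proj (.inl a) : (ι ⊕ κ → ℝ) →L[ℝ] ℝ)) w :=
      hasFDerivAt_restrict Sum.inl w
    have e2 : HasFDerivAt (fun w : ι ⊕ κ → ℝ => fun a => w (.inr a))
        (ContinuousLinearMap.pi fun a : κ =>
          (ContinuousLinearMap.proj (.inr a) : (ι ⊕ κ → ℝ) →L[ℝ] ℝ)) w :=
      hasFDerivAt_restrict Sum.inr w
    have h : HasFDerivAt (tensorFun g1 f1) _ w :=
      ((hg1.differentiable (by simp) _).hasFDerivAt.comp w e1).mul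
        ((hf1.differentiable (by simp) _).hasFDerivAt.comp w e2)
    rw [pderiv, h.fderiv]
    cases a with
    | inl a =>
      have z1 : (fun i : ι => (Pi.single (Sum.inl a) 1 : ι ⊕ κ → ℝ) (.inl i)) = Pi.single a 1 := by
        funext i; simp [Pi.single_apply]
      have z2 : (fun _ : κ => (0 : ℝ)) = 0 := rfl
      simp only [List.filterMap_cons, iter_cons, tensorFun, hg2, hf2, pderiv, _root_.add_apply,
        _root_.smul_apply, ContinuousLinearMap.comp_apply, ContinuousLinearMap.coe_pi',
        ContinuousLinearMap.proj_apply, Sum.getLeft?_inl, Sum.getRight?_inl, z1]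
      simp [z2, mul_comm]
    | inr b =>
      have z1 : (fun i : κ => (Pi.single (Sum.inr b) 1 : ι ⊕ κ → ℝ) (.inr i)) = Pi.single b 1 := by
        funext i; simp [Pi.single_apply]
      have z2 : (fun _ : ι => (0 : ℝ)) = 0 := rfl
      simp only [List.filterMap_cons, iter_cons, tensorFun, hg2, hf2, pderiv, _root_.add_apply,
        _root_.smul_apply, ContinuousLinearMap.comp_apply, ContinuousLinearMap.coe_pi',
        ContinuousLinearMap.proj_apply, Sum.getLeft?_inr, Sum.getRight?_inr, z1]
      simp [z2]

lemma length_filterMap_sum (α : List (ι ⊕ κ)) :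
    (α.filterMap Sum.getLeft?).length + (α.filterMap Sum.getRight?).length = α.length := by
  induction α with
  | nil => rfl
  | cons a l ih => cases a <;> simp [List.filterMap_cons] <;> omega

lemma count_filterMap_left [BEq (ι ⊕ κ)] [LawfulBEq (ι ⊕ κ)]
    (α : List (ι ⊕ κ)) (a : ι) :
    (α.filterMap Sum.getLeft?).count a = α.count (.inl a) := by
  induction α with
  | nil => rfl
  | cons c l ih => cases c <;> simp [List.filterMap_cons, List.count_cons, ih, beq_iff_eq]

lemma count_filterMap_right [BEq (ι ⊕ κ)] [LawfulBEq (ι ⊕ κ)]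
    (α : List (ι ⊕ κ)) (a : κ) :
    (α.filterMap Sum.getRight?).count a = α.count (.inr a) := by
  induction α with
  | nil => rfl
  | cons c l ih => cases c <;> simp [List.filterMap_cons, List.count_cons, ih, beq_iff_eq]

lemma multiFactorial_sum (β : ι ⊕ κ → ℕ) : multiFactorial β =
    (multiFactorial fun j : ι => β (.inl j)) * (multiFactorial fun j : κ => β (.inr j)) := by
  simp [multiFactorial, Fintype.prod_sum_type]

lemma NormLE.tensor {s h M M' : ℝ} {g : (ι → ℝ) → ℂ} {f : (κ → ℝ) → ℂ} (hg : ContDiff ℝ ∞ g)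
    (hf : ContDiff ℝ ∞ f) (H : NormLE s h M g) (H' : NormLE s h M' f) (h0 : 0 ≤ h) :
    NormLE s h (M * M') (tensorFun g f) := by
  intro α β x
  have h1 := H (α.filterMap Sum.getLeft?) (fun a => β (.inl a)) (fun a => x (.inl a))
  have h2 := H' (α.filterMap Sum.getRight?) (fun a => β (.inr a)) (fun a => x (.inr a))
  have hM := H.nonneg
  have hM' := H'.nonneg
  have := mul_le_mul h1 h2 (by positivity) (by positivity)
  rw [iter_tensor hg hf, Fintype.prod_sum_type, Fintype.sum_sum_type, tensorFun, norm_mul, abs_mul,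
    ← length_filterMap_sum]
  rw [multiFactorial_sum, multiFactorial_sum β]
  simp only [← count_filterMap_left, ← count_filterMap_right]
  push_cast
  rw [Real.mul_rpow (by positivity) (by positivity), Real.mul_rpow (by positivity) (by positivity)]
  refine le_trans (le_of_eq (by ring)) (this.trans (le_of_eq ?_))
  ring

/-! ### Partial Fourier transforms -/

/-- The partial Fourier transform in the second variable,
`(x, η) ↦ (2π)^{-n/2} ∫ f(x, y) e^{σ i ⟨y, η⟩} dy` with `y ∈ ℝ^n`, for a sign `σ = ±1`.
It is `𝓕₂` for `σ = -1` and `𝓕₂⁻¹` for `σ = 1`. -/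
def partialFourierFun (σ : ℤˣ) (f : (ι ⊕ κ → ℝ) → ℂ) : (ι ⊕ κ → ℝ) → ℂ := fun w =>
  ((2 * Real.pi) ^ (-(Fintype.card κ : ℝ) / 2) : ℝ) *
    ∫ y : κ → ℝ, f (Sum.elim (fun a => w (.inl a)) y) *
      Complex.exp (((σ : ℤ) : ℂ) * Complex.I * ((y ⬝ᵥ fun b => w (.inr b) : ℝ) : ℂ))

/-- An integrable weight. -/
def wt (y : κ → ℝ) : ℝ := ∏ j, (1 + y j ^ 2)⁻¹

lemma wt_pos (y : κ → ℝ) : 0 < wt y := Finset.prod_pos fun _ _ => by positivity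

lemma integrable_wt : Integrable (wt : (κ → ℝ) → ℝ) :=
  Integrable.fintype_prod (f := fun _ : κ => fun t : ℝ => (1 + t ^ 2)⁻¹)
    (fun _ => integrable_inv_one_add_sq)

lemma JB.decay {N : ℕ} {h M : ℝ} {g : (ι ⊕ κ → ℝ) → ℂ} (H : JB N h M g) (h1 : 1 ≤ h)
    (x : ι → ℝ) (y : κ → ℝ) : ‖g (Sum.elim x y)‖ ≤
      2 ^ Fintype.card κ * h ^ (2 * Fintype.card κ) * M *
        √((N + 2 * Fintype.card κ)! : ℝ) * wt y := by
  have hM := H.nonneg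
  have key : (∏ j, (1 + y j ^ 2)) * ‖g (Sum.elim x y)‖ ≤
      2 ^ Fintype.card κ * h ^ (2 * Fintype.card κ) * M *
        √((N + 2 * Fintype.card κ)! : ℝ) := by
    rw [Finset.prod_one_add, Finset.sum_mul]
    have : ∀ t ∈ (Finset.univ : Finset κ).powerset, (∏ j ∈ t, y j ^ 2) * ‖g (Sum.elim x y)‖ ≤
        M * (h ^ (2 * Fintype.card κ) * √((N + 2 * Fintype.card κ)! : ℝ)) := by
      intro t _
      have h2 := H.2 [] (Sum.elim 0 fun j => if j ∈ t then 2 else 0) (Sum.elim x y)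
      have e1 : ∏ j, (Sum.elim x y j) ^ ((Sum.elim 0 fun j => if j ∈ t then 2 else 0 :
          ι ⊕ κ → ℕ) j) = ∏ j ∈ t, y j ^ 2 := by
        rw [Fintype.prod_sum_type]
        simp [pow_ite, Finset.prod_ite_mem]
      have e2 : ∑ j, (Sum.elim 0 fun j => if j ∈ t then 2 else 0 : ι ⊕ κ → ℕ) j = 2 * t.card := by
        rw [Fintype.sum_sum_type]
        simp [Finset.sum_ite_mem, mul_comm]
      rw [e1, e2, abs_of_nonneg (Finset.prod_nonneg fun _ _ => sq_nonneg _)] at h2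
      refine h2.trans ?_
      have ht : t.card ≤ Fintype.card κ := Finset.card_le_univ t
      simp only [List.length_nil, zero_add]
      rw [add_comm (2 * t.card) N]
      gcongr
    refine (Finset.sum_le_card_nsmul _ _ _ this).trans (le_of_eq ?_)
    rw [Finset.card_powerset, Finset.card_univ, nsmul_eq_mul]
    push_cast; ring
  rw [wt, Finset.prod_inv_distrib, ← div_eq_mul_inv, le_div_iff₀
    (Finset.prod_pos fun _ _ => by positivity), mul_comm]
  exact key

lemma Nice.decay {g : (ι ⊕ κ → ℝ) → ℂ} (H : Nice g) :
    ∃ C, 0 ≤ C ∧ ∀ x y, ‖g (Sum.elim x y)‖ ≤ C * wt y := by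
  obtain ⟨N, h, M, h1, H⟩ := H
  have := H.nonneg
  exact ⟨_, by positivity, H.decay h1⟩

lemma Nice.pderiv {g : (ι → ℝ) → ℂ} (H : Nice g) (j : ι) : Nice (pderiv j g) := by
  obtain ⟨N, h, M, h1, H⟩ := H
  exact ⟨_, _, _, h1, H.pderiv j⟩

lemma Nice.mulX {g : (ι → ℝ) → ℂ} (H : Nice g) (j : ι) : Nice (mulX j g) := by
  obtain ⟨N, h, M, h1, H⟩ := H
  exact ⟨_, _, _, h1, H.mulX j h1⟩

/-- The exponential factor. -/
def ker (σ : ℤˣ) (y ξ : κ → ℝ) : ℂ :=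
  Complex.exp (((σ : ℤ) : ℂ) * Complex.I * ((y ⬝ᵥ ξ : ℝ) : ℂ))

lemma norm_ker (σ : ℤˣ) (y ξ : κ → ℝ) : ‖ker σ y ξ‖ = 1 := by
  rw [ker, show ((σ : ℤ) : ℂ) * Complex.I * ((y ⬝ᵥ ξ : ℝ) : ℂ) =
    (((σ : ℤ) * (y ⬝ᵥ ξ) : ℝ) : ℂ) * Complex.I by push_cast; ring, Complex.norm_exp_ofReal_mul_I]

lemma continuous_ker (σ : ℤˣ) (ξ : κ → ℝ) : Continuous fun y : κ → ℝ => ker σ y ξ := by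
  unfold ker dotProduct; fun_prop

lemma hasFDerivAt_dot (y ξ : κ → ℝ) : HasFDerivAt (fun ξ : κ → ℝ => y ⬝ᵥ ξ)
    (∑ j, y j • (ContinuousLinearMap.proj j : (κ → ℝ) →L[ℝ] ℝ)) ξ := by
  unfold dotProduct
  apply HasFDerivAt.fun_sum
  intro j _
  exact (ContinuousLinearMap.hasFDerivAt
    (ContinuousLinearMap.proj j : (κ → ℝ) →L[ℝ] ℝ)).const_mul _

lemma hasFDerivAt_ker (σ : ℤˣ) (y ξ : κ → ℝ) : HasFDerivAt (fun ξ => ker σ y ξ)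
    (ker σ y ξ • ((((σ : ℤ) : ℂ) * Complex.I) • Complex.ofRealCLM.comp
      (∑ j, y j • (ContinuousLinearMap.proj j : (κ → ℝ) →L[ℝ] ℝ)))) ξ :=
  ((Complex.ofRealCLM.hasFDerivAt.comp ξ (hasFDerivAt_dot y ξ)).const_mul _).cexp

lemma ker_symm (σ : ℤˣ) (y ξ : κ → ℝ) : ker σ y ξ = ker σ ξ y := by
  rw [ker, ker, dotProduct_comm]

lemma Nice.integrable {g : (ι ⊕ κ → ℝ) → ℂ} (H : Nice g) (σ : ℤˣ) (x : ι → ℝ) (ξ : κ → ℝ) :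
    Integrable fun y : κ → ℝ => g (Sum.elim x y) * ker σ y ξ := by
  obtain ⟨C, hC, hd⟩ := H.decay
  refine (integrable_wt.const_mul C).mono' ?_ ?_
  · apply Continuous.aestronglyMeasurable
    refine (H.contDiff.continuous.comp ?_).mul (continuous_ker σ ξ)
    refine continuous_pi fun j => ?_
    cases j <;> simp <;> fun_prop
  · filter_upwards with y
    rw [norm_mul, norm_ker, mul_one]
    exact hd x y

/-- The derivative of the integrand. -/
def dker (σ : ℤˣ) (g : (ι ⊕ κ → ℝ) → ℂ) (w : ι ⊕ κ → ℝ) (y : κ → ℝ) : (ι ⊕ κ → ℝ) →L[ℝ] ℂ :=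
  ∑ a, (ContinuousLinearMap.proj (.inl a) : (ι ⊕ κ → ℝ) →L[ℝ] ℝ).smulRight
      (pderiv (.inl a) g (Sum.elim (fun a => w (.inl a)) y) * ker σ y (fun b => w (.inr b))) +
    ∑ b, (ContinuousLinearMap.proj (.inr b) : (ι ⊕ κ → ℝ) →L[ℝ] ℝ).smulRight
      (((σ : ℤ) : ℂ) * Complex.I * (mulX (.inr b) g (Sum.elim (fun a => w (.inl a)) y) *
        ker σ y (fun b => w (.inr b))))

lemma hasFDerivAt_integrand {g : (ι ⊕ κ → ℝ) → ℂ} (H : Nice g) (σ : ℤˣ) (w : ι ⊕ κ → ℝ)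
    (y : κ → ℝ) : HasFDerivAt (fun w : ι ⊕ κ → ℝ => g (Sum.elim (fun a => w (.inl a)) y) *
      ker σ y (fun b => w (.inr b))) (dker σ g w y) w := by
  have e1 : HasFDerivAt (fun w : ι ⊕ κ → ℝ => Sum.elim (fun a => w (.inl a)) y)
      (ContinuousLinearMap.pi (Sum.elim (fun a : ι =>
        (ContinuousLinearMap.proj (.inl a) : (ι ⊕ κ → ℝ) →L[ℝ] ℝ)) fun _ => 0)) w := by
    rw [hasFDerivAt_pi']
    intro j
    cases j with
    | inl a => exact (ContinuousLinearMap.proj (.inl a) : (ι ⊕ κ → ℝ) →L[ℝ] ℝ).hasFDerivAt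
    | inr b => exact hasFDerivAt_const _ _
  have e2 : HasFDerivAt (fun w : ι ⊕ κ → ℝ => fun a => w (.inr a))
      (ContinuousLinearMap.pi fun a : κ =>
        (ContinuousLinearMap.proj (.inr a) : (ι ⊕ κ → ℝ) →L[ℝ] ℝ)) w :=
      hasFDerivAt_restrict Sum.inr w
  have h := ((H.differentiable _).hasFDerivAt.comp w e1).mul ((hasFDerivAt_ker σ y _).comp w e2)
  refine h.congr_fderiv ?_
  ext v
  simp only [dker, _root_.add_apply, _root_.smul_apply,
    ContinuousLinearMap.comp_apply, fderiv_eq_sum, Fintype.sum_sum_type]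
  simp [Finset.mul_sum, mulX, _root_.sum_apply]
  rw [add_comm]
  congr 1 <;> apply Finset.sum_congr rfl <;> intro i _ <;> ring

lemma dker_cont {g : (ι ⊕ κ → ℝ) → ℂ} (H : Nice g) (σ : ℤˣ) (w : ι ⊕ κ → ℝ) :
    Continuous (dker σ g w) := by
  have c1 : Continuous fun y : κ → ℝ => (Sum.elim (fun a => w (.inl a)) y : ι ⊕ κ → ℝ) := by
    refine continuous_pi fun j => ?_
    cases j <;> simp <;> fun_prop
  have c2 := continuous_ker σ (fun b => w (.inr b))
  unfold dker
  refine (continuous_finsetSum _ fun a _ => ?_).add (continuous_finsetSum _ fun b _ => ?_)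
  · exact ((ContinuousLinearMap.smulRightL ℝ (ι ⊕ κ → ℝ) ℂ _).continuous).comp
      (((H.pderiv _).contDiff.continuous.comp c1).mul c2)
  · exact ((ContinuousLinearMap.smulRightL ℝ (ι ⊕ κ → ℝ) ℂ _).continuous).comp
      (continuous_const.mul (((H.mulX _).contDiff.continuous.comp c1).mul c2))

lemma dker_bound {g : (ι ⊕ κ → ℝ) → ℂ} (H : Nice g) (σ : ℤˣ) :
    ∃ C, ∀ w y, ‖dker σ g w y‖ ≤ C * wt y := by
  choose C1 h1 h1' using fun a : ι => (H.pderiv (.inl a)).decay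
  choose C2 h2 h2' using fun b : κ => (H.mulX (.inr b)).decay
  have hs : ‖((σ : ℤ) : ℂ) * Complex.I‖ = 1 := by
    rcases Int.units_eq_one_or σ with h | h <;> simp [h]
  refine ⟨∑ a, C1 a + ∑ b, C2 b, fun w y => ?_⟩
  have hp : ∀ j : ι ⊕ κ, ‖(ContinuousLinearMap.proj j : (ι ⊕ κ → ℝ) →L[ℝ] ℝ)‖ ≤ 1 := fun j =>
    ContinuousLinearMap.opNorm_le_bound _ zero_le_one fun v => by
      simpa using norm_le_pi_norm v j
  have hy := (wt_pos y).le
  unfold dker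
  rw [add_mul, Finset.sum_mul, Finset.sum_mul]
  refine (norm_add_le _ _).trans (add_le_add ?_ ?_)
  · refine (norm_sum_le _ _).trans (Finset.sum_le_sum fun a _ => ?_)
    rw [ContinuousLinearMap.norm_smulRight_apply, norm_mul, norm_ker, mul_one]
    calc _ ≤ 1 * (C1 a * wt y) := by gcongr; exacts [hp _, h1' a _ _]
      _ = _ := one_mul _
  · refine (norm_sum_le _ _).trans (Finset.sum_le_sum fun a _ => ?_)
    rw [ContinuousLinearMap.norm_smulRight_apply, norm_mul, hs, one_mul, norm_mul, norm_ker,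
      mul_one]
    calc _ ≤ 1 * (C2 a * wt y) := by gcongr; exacts [hp _, h2' a _ _]
      _ = _ := one_mul _

lemma hasFDerivAt_integral {g : (ι ⊕ κ → ℝ) → ℂ} (H : Nice g) (σ : ℤˣ) (w : ι ⊕ κ → ℝ) :
    HasFDerivAt (fun w : ι ⊕ κ → ℝ => ∫ y, g (Sum.elim (fun a => w (.inl a)) y) *
      ker σ y (fun b => w (.inr b))) (∫ y, dker σ g w y) w := by
  obtain ⟨C, hC⟩ := dker_bound H σ
  refine hasFDerivAt_integral_of_dominated_of_fderiv_le (bound := fun y => C * wt y) Filter.univ_mem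
    (Filter.Eventually.of_forall fun w => (H.integrable σ _ _).aestronglyMeasurable)
    (H.integrable σ _ _) (dker_cont H σ w).aestronglyMeasurable
    (Filter.Eventually.of_forall fun y w _ => hC w y) (integrable_wt.const_mul C)
    (Filter.Eventually.of_forall fun y w _ => hasFDerivAt_integrand H σ w y)

lemma integrable_dker {g : (ι ⊕ κ → ℝ) → ℂ} (H : Nice g) (σ : ℤˣ) (w : ι ⊕ κ → ℝ) :
    Integrable (dker σ g w) := by
  obtain ⟨C, hC⟩ := dker_bound H σ
  exact (integrable_wt.const_mul C).mono' (dker_cont H σ w).aestronglyMeasurable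
    (Filter.Eventually.of_forall fun y => hC w y)

lemma partialFourierFun_eq (σ : ℤˣ) (f : (ι ⊕ κ → ℝ) → ℂ) (w : ι ⊕ κ → ℝ) :
    partialFourierFun σ f w = ((2 * Real.pi) ^ (-(Fintype.card κ : ℝ) / 2) : ℝ) *
    ∫ y : κ → ℝ, f (Sum.elim (fun a => w (.inl a)) y) * ker σ y (fun b => w (.inr b)) := rfl

lemma partialFourierFun_smul (σ : ℤˣ) (c : ℂ) (f : (ι ⊕ κ → ℝ) → ℂ) :
    partialFourierFun σ (c • f) = c • partialFourierFun σ f := by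
  funext w
  simp only [partialFourierFun_eq, Pi.smul_apply, smul_eq_mul, mul_assoc]
  rw [integral_const_mul]
  ring

lemma partialFourierFun_add (σ : ℤˣ) {f g : (ι ⊕ κ → ℝ) → ℂ} (hf : Nice f) (hg : Nice g) :
    partialFourierFun σ (f + g) = partialFourierFun σ f + partialFourierFun σ g := by
  funext w
  simp only [partialFourierFun_eq, Pi.add_apply, add_mul]
  rw [integral_add (hf.integrable σ _ _) (hg.integrable σ _ _)]
  ring

lemma integral_by_parts {g : (ι ⊕ κ → ℝ) → ℂ} (H : Nice g) (σ : ℤˣ) (x : ι → ℝ) (ξ : κ → ℝ)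
    (b : κ) : (ξ b : ℂ) * ∫ y, g (Sum.elim x y) * ker σ y ξ =
      ((σ : ℤ) : ℂ) * Complex.I * ∫ y, pderiv (.inr b) g (Sum.elim x y) * ker σ y ξ := by
  have e1 : ∀ y, HasFDerivAt (fun y : κ → ℝ => (Sum.elim x y : ι ⊕ κ → ℝ))
      (ContinuousLinearMap.pi (Sum.elim (fun _ : ι => 0) fun b =>
        (ContinuousLinearMap.proj b : (κ → ℝ) →L[ℝ] ℝ))) y := by
    intro y
    rw [hasFDerivAt_pi']
    intro j
    cases j with
    | inl a => exact hasFDerivAt_const _ _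
    | inr b => exact (ContinuousLinearMap.proj b : (κ → ℝ) →L[ℝ] ℝ).hasFDerivAt
  have e2 : ∀ y, HasFDerivAt (fun y => g (Sum.elim x y)) _ y := fun y =>
    (H.differentiable _).hasFDerivAt.comp y (e1 y)
  have e3 : ∀ y, HasFDerivAt (fun y => ker σ y ξ) _ y := fun y => by
    simp_rw [ker_symm σ _ ξ]
    exact hasFDerivAt_ker σ ξ y
  have d2 : ∀ y, fderiv ℝ (fun y => g (Sum.elim x y)) y (Pi.single b 1) =
      pderiv (.inr b) g (Sum.elim x y) := by
    intro y
    rw [(e2 y).fderiv, ContinuousLinearMap.comp_apply, pderiv]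
    congr 1
    funext j
    cases j <;> simp [Pi.single_apply]
  have d3 : ∀ y, fderiv ℝ (fun y => ker σ y ξ) y (Pi.single b 1) =
      ((σ : ℤ) : ℂ) * Complex.I * ξ b * ker σ y ξ := by
    intro y
    rw [(e3 y).fderiv, ker_symm σ y ξ]
    simp [_root_.sum_apply, Pi.single_apply]
    ring
  have := integral_mul_fderiv_eq_neg_fderiv_mul_of_integrable (μ := (volume : Measure (κ → ℝ)))
    (f := fun y => g (Sum.elim x y)) (g := fun y => ker σ y ξ) (v := Pi.single b 1)
    (by simpa only [d2] using (H.pderiv (.inr b)).integrable σ x ξ)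
    (by
      simp only [d3]
      have := (H.integrable σ x ξ).const_mul (((σ : ℤ) : ℂ) * Complex.I * ξ b)
      refine this.congr (Filter.Eventually.of_forall fun y => ?_)
      simp only; ring)
    (H.integrable σ x ξ) (fun y _ => (e2 y).differentiableAt) (fun y _ => (e3 y).differentiableAt)
  simp only [d2, d3] at this
  have h4 : ∫ y, g (Sum.elim x y) * (((σ : ℤ) : ℂ) * Complex.I * ξ b * ker σ y ξ) =
      ((σ : ℤ) : ℂ) * Complex.I * ξ b * ∫ y, g (Sum.elim x y) * ker σ y ξ := by
    rw [← integral_const_mul]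
    congr 1; funext y; ring
  rw [h4] at this
  have hs : (((σ : ℤ) : ℂ) * Complex.I) * (((σ : ℤ) : ℂ) * Complex.I) = -1 := by
    rcases Int.units_eq_one_or σ with h | h <;> simp [h]
  linear_combination (-(((σ : ℤ) : ℂ) * Complex.I)) * this +
    (ξ b : ℂ) * (∫ y, g (Sum.elim x y) * ker σ y ξ) * hs

lemma transfers_partialFourier (σ : ℤˣ) :
    Transfers (partialFourierFun σ : ((ι ⊕ κ → ℝ) → ℂ) → (ι ⊕ κ → ℝ) → ℂ) where
  diff g hg := fun w => (hasFDerivAt_integral hg σ w).differentiableAt.const_mul _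
  bound := by
    refine ⟨2 * Fintype.card κ, fun h h1 => ⟨|(2 * Real.pi) ^ (-(Fintype.card κ : ℝ) / 2)| *
      (2 ^ Fintype.card κ * h ^ (2 * Fintype.card κ) * ∫ y : κ → ℝ, wt y), ?_, ?_⟩⟩
    · have : 0 ≤ ∫ y : κ → ℝ, wt y := integral_nonneg fun y => (wt_pos y).le
      positivity
    · intro N M g hg w
      rw [partialFourierFun_eq, norm_mul, Complex.norm_real, Real.norm_eq_abs, mul_assoc, mul_assoc]
      gcongr
      have := norm_integral_le_of_norm_le (integrable_wt.const_mul
        (2 ^ Fintype.card κ * h ^ (2 * Fintype.card κ) * M * √((N + 2 * Fintype.card κ)! : ℝ)))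
        (f := fun y : κ → ℝ => g (Sum.elim (fun a => w (.inl a)) y) *
          ker σ y (fun b => w (.inr b)))
        (Filter.Eventually.of_forall fun y => by
          rw [norm_mul, norm_ker, mul_one]; exact hg.decay h1 _ y)
      refine this.trans (le_of_eq ?_)
      rw [integral_const_mul]; ring
  pderiv j := by
    have hd : ∀ g : (ι ⊕ κ → ℝ) → ℂ, Nice g → ∀ w v, fderiv ℝ (partialFourierFun σ g) w v =
        ((2 * Real.pi) ^ (-(Fintype.card κ : ℝ) / 2) : ℝ) * ∫ y, dker σ g w y v := by
      intro g hg w v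
      have : HasFDerivAt (partialFourierFun σ g) _ w :=
        (hasFDerivAt_integral hg σ w).const_mul (((2 * Real.pi) ^ (-(Fintype.card κ : ℝ) / 2) : ℝ) : ℂ)
      rw [this.fderiv, _root_.smul_apply, smul_eq_mul,
        ContinuousLinearMap.integral_apply (integrable_dker hg σ w)]
    cases j with
    | inl a =>
      refine ⟨0, Pi.single (.inl a) 1, fun g hg => ?_⟩
      rw [lin_zero_single, one_smul]
      funext w
      rw [GelfandShilov.pderiv, hd g hg, partialFourierFun_eq]
      congr 2
      funext y
      simp [dker, _root_.sum_apply, Pi.single_apply]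
    | inr b =>
      refine ⟨Pi.single (.inr b) (((σ : ℤ) : ℂ) * Complex.I), 0, fun g hg => ?_⟩
      rw [lin_single_zero, partialFourierFun_smul]
      funext w
      rw [GelfandShilov.pderiv, hd g hg, Pi.smul_apply, partialFourierFun_eq, smul_eq_mul,
        mul_left_comm (((σ : ℤ) : ℂ) * Complex.I), ← integral_const_mul (((σ : ℤ) : ℂ) * Complex.I)]
      congr 2
      funext y
      simp [dker, _root_.sum_apply, Pi.single_apply]
  mulX j := by
    cases j with
    | inl a =>
      refine ⟨Pi.single (.inl a) 1, 0, fun g hg => ?_⟩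
      rw [lin_single_zero, one_smul]
      funext w
      rw [GelfandShilov.mulX, partialFourierFun_eq, partialFourierFun_eq, mul_left_comm,
        ← integral_const_mul]
      congr 2
      funext y
      simp [GelfandShilov.mulX, mul_assoc]
    | inr b =>
      refine ⟨0, Pi.single (.inr b) (((σ : ℤ) : ℂ) * Complex.I), fun g hg => ?_⟩
      rw [lin_zero_single, partialFourierFun_smul]
      funext w
      rw [GelfandShilov.mulX, Pi.smul_apply, partialFourierFun_eq, partialFourierFun_eq,
        smul_eq_mul, mul_left_comm, integral_by_parts hg σ _ (fun b => w (.inr b)) b]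
      ring

end

section
variable {ι κ : Type*} [Fintype ι] [DecidableEq ι] [Fintype κ] [DecidableEq κ]

lemma Transfers.isContinuous {T : ((ι → ℝ) → ℂ) → (κ → ℝ) → ℂ} (hT : Transfers T)
    {S : Space (1 / 2) ι →ₗ[ℂ] Space (1 / 2) κ} (hS : ∀ f, (S f : (κ → ℝ) → ℂ) = T f) :
    IsContinuous S := by
  intro h h0
  obtain ⟨h', h0', C, H⟩ := hT.normLE h
  exact ⟨h', h0', C, fun f M hM => by rw [hS]; exact H f M f.2.1 hM h0.le⟩

lemma IsContinuous.comp {τ : Type*} [Fintype τ] [DecidableEq τ]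
    {S : Space (1 / 2) κ →ₗ[ℂ] Space (1 / 2) τ} {T : Space (1 / 2) ι →ₗ[ℂ] Space (1 / 2) κ}
    (hS : IsContinuous S) (hT : IsContinuous T) : IsContinuous (S ∘ₗ T) := by
  intro h h0
  obtain ⟨h', h0', C, H⟩ := hT h h0
  obtain ⟨h2, h02, C2, H2⟩ := hS h' h0'
  exact ⟨h2, h02, C2 * C, fun f M hM => by rw [mul_assoc]; exact H2 _ _ (H f M hM)⟩

/-- Composition with a linear bijection, on test functions. -/
def compLin (L : (κ → ℝ) ≃ₗ[ℝ] (ι → ℝ)) : Space (1 / 2) ι →ₗ[ℂ] Space (1 / 2) κ where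
  toFun f := ⟨fun x => (f : (ι → ℝ) → ℂ) (L x), (transfers_comp L).mem f.2⟩
  map_add' _ _ := rfl
  map_smul' _ _ := rfl

lemma isContinuous_compLin (L : (κ → ℝ) ≃ₗ[ℝ] (ι → ℝ)) : IsContinuous (compLin L) :=
  (transfers_comp L).isContinuous fun _ => rfl

/-- Multiplication by `e^{i⟨Ay, x⟩}` on test functions of `(x, y)`. -/
def chirp (A : Matrix ι κ ℝ) : Space (1 / 2) (ι ⊕ κ) →ₗ[ℂ] Space (1 / 2) (ι ⊕ κ) where
  toFun f := ⟨chirpFun A f, (transfers_chirp A).mem f.2⟩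
  map_add' f g := by ext w; exact mul_add _ _ _
  map_smul' c f := by ext w; exact mul_left_comm _ _ _

lemma isContinuous_chirp (A : Matrix ι κ ℝ) : IsContinuous (chirp A) :=
  (transfers_chirp A).isContinuous fun _ => rfl

/-- The partial Fourier transform with sign `σ` on test functions. -/
def partialFourier (σ : ℤˣ) : Space (1 / 2) (ι ⊕ κ) →ₗ[ℂ] Space (1 / 2) (ι ⊕ κ) where
  toFun f := ⟨partialFourierFun σ f, (transfers_partialFourier σ).mem f.2⟩
  map_add' f g := by
    apply Subtype.ext
    change partialFourierFun σ ((f : (ι ⊕ κ → ℝ) → ℂ) + (g : (ι ⊕ κ → ℝ) → ℂ)) = _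
    rw [partialFourierFun_add σ (nice_of_mem f.2) (nice_of_mem g.2)]
    rfl
  map_smul' c f := by
    apply Subtype.ext
    change partialFourierFun σ (c • (f : (ι ⊕ κ → ℝ) → ℂ)) = _
    rw [partialFourierFun_smul]
    rfl

lemma isContinuous_partialFourier (σ : ℤˣ) :
    IsContinuous (partialFourier σ : Space (1 / 2) (ι ⊕ κ) →ₗ[ℂ] Space (1 / 2) (ι ⊕ κ)) :=
  (transfers_partialFourier σ).isContinuous fun _ => rfl

/-- The Fourier transform `ξ ↦ (2π)^{-n/2} ∫ f(x) e^{σ i ⟨x, ξ⟩} dx` with a sign `σ = ±1`: it is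
`𝓕` for `σ = -1` and `𝓕⁻¹` for `σ = 1`. -/
def fourierFun (σ : ℤˣ) (f : (ι → ℝ) → ℂ) : (ι → ℝ) → ℂ := fun ξ =>
  ((2 * Real.pi) ^ (-(Fintype.card ι : ℝ) / 2) : ℝ) *
    ∫ x : ι → ℝ, f x * Complex.exp (((σ : ℤ) : ℂ) * Complex.I * ((x ⬝ᵥ ξ : ℝ) : ℂ))

/-- The identification of `ℝ^0 × ℝ^n` with `ℝ^n`. -/
def emptySum (ι : Type*) : (PEmpty.{1} ⊕ ι → ℝ) ≃ₗ[ℝ] (ι → ℝ) where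
  toFun w := fun i => w (.inr i)
  invFun x := Sum.elim (fun e => e.elim) x
  map_add' _ _ := rfl
  map_smul' _ _ := rfl
  left_inv w := by funext j; rcases j with j | j; exacts [j.elim, rfl]
  right_inv _ := rfl

/-- The Fourier transform as a partial Fourier transform without parameters. -/
def fourierAux (σ : ℤˣ) : Space (1 / 2) ι →ₗ[ℂ] Space (1 / 2) ι :=
  compLin (emptySum ι).symm ∘ₗ partialFourier σ ∘ₗ compLin (emptySum ι)

lemma fourierAux_apply (σ : ℤˣ) (f : Space (1 / 2) ι) :
    (fourierAux σ f : (ι → ℝ) → ℂ) = fourierFun σ f := rfl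

/-- The Fourier transform with sign `σ` on test functions. -/
def fourier (σ : ℤˣ) : Space (1 / 2) ι →ₗ[ℂ] Space (1 / 2) ι where
  toFun f := ⟨fourierFun σ f, (fourierAux σ f).2⟩
  map_add' f g := (fourierAux σ).map_add f g
  map_smul' c f := (fourierAux σ).map_smul c f

lemma isContinuous_fourier (σ : ℤˣ) : IsContinuous (fourier σ : Space (1 / 2) ι →ₗ[ℂ] _) :=
  ((isContinuous_compLin _).comp ((isContinuous_partialFourier σ).comp (isContinuous_compLin _)) :
    IsContinuous (fourierAux σ))

/-- The transpose `⟨Tᵗu, f⟩ = ⟨u, T f⟩` of a continuous map of test functions. -/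
def transpose (T : Space (1 / 2) ι →ₗ[ℂ] Space (1 / 2) κ) (hT : IsContinuous T) :
    Dual (1 / 2) κ →ₗ[ℂ] Dual (1 / 2) ι where
  toFun u := ⟨(u : Space (1 / 2) κ →ₗ[ℂ] ℂ) ∘ₗ T, by
    intro h h0
    obtain ⟨h', h0', C, H⟩ := hT h h0
    obtain ⟨C', H'⟩ := u.2 h' h0'
    exact ⟨C' * C, fun f M hM => by rw [mul_assoc]; exact H' _ _ (H f M hM)⟩⟩
  map_add' _ _ := rfl
  map_smul' _ _ := rfl

/-- The composition `u ∘ L` of a distribution with a linear bijection,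
`⟨u ∘ L, f⟩ = |det L|⁻¹ ⟨u, f ∘ L⁻¹⟩`. -/
def pullback (L : (ι → ℝ) ≃ₗ[ℝ] (ι → ℝ)) : Dual (1 / 2) ι →ₗ[ℂ] Dual (1 / 2) ι :=
  ((|LinearMap.det (L : (ι → ℝ) →ₗ[ℝ] (ι → ℝ))|⁻¹ : ℝ) : ℂ) •
    transpose (compLin L.symm) (isContinuous_compLin L.symm)

/-- The tensor product `g ⊗ f` of test functions. -/
def tensor (g : Space (1 / 2) ι) (f : Space (1 / 2) κ) : Space (1 / 2) (ι ⊕ κ) :=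
  ⟨tensorFun g f, by
    obtain ⟨hg, h, h0, C, H⟩ := g.2
    obtain ⟨hf, h', h0', C', H'⟩ := f.2
    exact ⟨contDiff_tensor hg hf, max h h', lt_max_of_lt_left h0, C * C',
      NormLE.tensor hg hf (H.mono h0.le (le_max_left _ _)) (H'.mono h0'.le (le_max_right _ _))
        (h0.le.trans (le_max_left _ _))⟩⟩

/-- The operator `T_K` with distribution kernel `K`, given by `⟨T_K f, g⟩ = ⟨K, g ⊗ f⟩` in terms
of the bilinear pairing of distributions and test functions. (With the sesquilinear pairing
`(u, g) = ⟨u, conj g⟩` this reads `(T_K f, g) = (K, g ⊗ conj f)`.) -/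
def kernelOp (K : Dual (1 / 2) (ι ⊕ κ)) : Space (1 / 2) κ →ₗ[ℂ] Dual (1 / 2) ι where
  toFun f := ⟨{ toFun := fun g => (K : Space (1 / 2) (ι ⊕ κ) →ₗ[ℂ] ℂ) (tensor g f)
                map_add' := fun g g' => by
                  rw [← map_add]; congr 1; ext w; exact add_mul _ _ _
                map_smul' := fun c g => by
                  rw [← map_smul]; congr 1; ext w; exact mul_assoc _ _ _ }, by
    intro h h0
    obtain ⟨hf, h', h0', C', H'⟩ := f.2
    obtain ⟨C, H⟩ := K.2 (max h h') (lt_max_of_lt_left h0)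
    refine ⟨C * C', fun g M hM => (H (tensor g f) (M * C') ?_).trans (le_of_eq (by ring))⟩
    exact NormLE.tensor g.2.1 hf (hM.mono h0.le (le_max_left _ _))
      (H'.mono h0'.le (le_max_right _ _)) (h0.le.trans (le_max_left _ _))⟩
  map_add' f f' := by
    ext g
    change (K : Space (1 / 2) (ι ⊕ κ) →ₗ[ℂ] ℂ) _ = (K : Space (1 / 2) (ι ⊕ κ) →ₗ[ℂ] ℂ) _ +
      (K : Space (1 / 2) (ι ⊕ κ) →ₗ[ℂ] ℂ) _
    rw [← map_add]; congr 1; ext w; exact mul_add _ _ _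
  map_smul' c f := by
    ext g
    change (K : Space (1 / 2) (ι ⊕ κ) →ₗ[ℂ] ℂ) _ = c • (K : Space (1 / 2) (ι ⊕ κ) →ₗ[ℂ] ℂ) _
    rw [← map_smul]; congr 1; ext w; exact mul_left_comm _ _ _

/-- The linear bijection `(x, y) ↦ (x - A(x - y), x - y)`. -/
def kernelMap (A : Matrix ι ι ℝ) : (ι ⊕ ι → ℝ) ≃ₗ[ℝ] (ι ⊕ ι → ℝ) where
  toFun w :=
    let x : ι → ℝ := fun i => w (.inl i)
    let y : ι → ℝ := fun i => w (.inr i)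
    Sum.elim (x - A.mulVec (x - y)) (x - y)
  invFun v :=
    let u : ι → ℝ := fun i => v (.inl i)
    let z : ι → ℝ := fun i => v (.inr i)
    Sum.elim (u + A.mulVec z) (u + A.mulVec z - z)
  map_add' w w' := by
    funext j
    rcases j with j | j
    · simp [Matrix.mulVec, dotProduct, mul_sub, mul_add, Finset.sum_add_distrib]; ring
    · simp; ring
  map_smul' c w := by
    funext j
    rcases j with j | j
    · simp [Matrix.mulVec, dotProduct, mul_sub, Finset.mul_sum, mul_left_comm]
    · simp; ring
  left_inv w := by
    funext j
    rcases j with j | j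
    · change _ - A.mulVec _ j + A.mulVec _ j = _
      exact sub_add_cancel _ _
    · change w (.inl j) - A.mulVec _ j + A.mulVec _ j - (w (.inl j) - w (.inr j)) = _
      exact (congrArg (· - (w (.inl j) - w (.inr j))) (sub_add_cancel _ _)).trans
        (sub_sub_cancel _ _)
  right_inv v := by
    funext j
    rcases j with j | j
    · have : ((fun i => v (.inl i)) + A.mulVec (fun i => v (.inr i)) -
          ((fun i => v (.inl i)) + A.mulVec (fun i => v (.inr i)) - fun i => v (.inr i))) =
          fun i => v (.inr i) := sub_sub_cancel _ _
      simp only [Sum.elim_inl, Sum.elim_inr]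
      change ((fun i => v (.inl i)) + A.mulVec (fun i => v (.inr i)) - A.mulVec
        ((fun i => v (.inl i)) + A.mulVec (fun i => v (.inr i)) -
          ((fun i => v (.inl i)) + A.mulVec (fun i => v (.inr i)) - fun i => v (.inr i)))) j = _
      rw [this]; simp
    · simp

/-- The Fourier transform `𝓕` of distributions. -/
def distFourier : Dual (1 / 2) ι →ₗ[ℂ] Dual (1 / 2) ι :=
  transpose (fourier (-1)) (isContinuous_fourier (-1))

/-- The inverse Fourier transform `𝓕⁻¹` of distributions. -/
def distFourierInv : Dual (1 / 2) ι →ₗ[ℂ] Dual (1 / 2) ι :=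
  transpose (fourier 1) (isContinuous_fourier 1)

/-- The inverse partial Fourier transform `𝓕₂⁻¹` of distributions, in the second variable. -/
def distPartialFourierInv : Dual (1 / 2) (ι ⊕ κ) →ₗ[ℂ] Dual (1 / 2) (ι ⊕ κ) :=
  transpose (partialFourier 1) (isContinuous_partialFourier 1)

/-- Multiplication of distributions in `(x, y)` by the function `e^{i⟨Ay, x⟩}`. -/
def distChirp (A : Matrix ι κ ℝ) : Dual (1 / 2) (ι ⊕ κ) →ₗ[ℂ] Dual (1 / 2) (ι ⊕ κ) :=
  transpose (chirp A) (isContinuous_chirp A)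

/-- The distribution kernel
`K_{a,A}(x, y) = (2π)^{-d/2} (𝓕₂⁻¹ a)(x - A(x - y), x - y)`. -/
def kernel (A : Matrix ι ι ℝ) (a : Dual (1 / 2) (ι ⊕ ι)) : Dual (1 / 2) (ι ⊕ ι) :=
  (((2 * Real.pi) ^ (-(Fintype.card ι : ℝ) / 2) : ℝ) : ℂ) •
    pullback (kernelMap A) (distPartialFourierInv a)

/-- The pseudo-differential operator `Op_A(a)`, from `S_{1/2}(ℝ^d)` to `S_{1/2}'(ℝ^d)`, with
distribution kernel `K_{a,A}`. -/
def Op (A : Matrix ι ι ℝ) (a : Dual (1 / 2) (ι ⊕ ι)) : Space (1 / 2) ι →ₗ[ℂ] Dual (1 / 2) ι :=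
  kernelOp (kernel A a)

/-- The distribution `e^{i⟨A D_ξ, D_x⟩} a`, where `D = -i∂` and `a` is a distribution in `(x, ξ)`:
the Fourier multiplier whose symbol is obtained by substituting the dual variable `η` of `x` for
`D_x` and the dual variable `z` of `ξ` for `D_ξ`, that is
`𝓕⁻¹ (e^{i⟨Az, η⟩} (𝓕 a)(η, z))`. -/
def expMultiplier (A : Matrix ι ι ℝ) (a : Dual (1 / 2) (ι ⊕ ι)) : Dual (1 / 2) (ι ⊕ ι) :=
  distFourierInv (distChirp A (distFourier a))

end

end GelfandShilov

end

set_option linter.unusedSectionVars false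

noncomputable section

namespace GelfandShilov

open MeasureTheory
open scoped ContDiff Nat

section
variable {ι κ : Type*} [Fintype ι] [DecidableEq ι] [Fintype κ] [DecidableEq κ]

/-! The equivalence is a chain of two: operators agree iff their kernels agree, and kernels agree
iff the Fourier multipliers agree.

Kernels and multipliers (`kernel_apply`, `kernel_eq_kernel_iff`). The map `(x, y) ↦ (x - A(x - y), x
- y)` is the map for `A = 0` followed by the shear `(u, z) ↦ (u - Az, z)`, which has determinant 1.
Under the Fourier transform a shear becomes multiplication by `e^{i⟨Az, η⟩}`
(`chirp_fourier_partialFourier`). Hence the kernel of `Op_A(a)` is the kernel of `Op_0(e^{i⟨A D_ξ,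
D_x⟩} a)`. For the fixed matrix 0, passing from symbol to kernel is, up to a nonzero constant, the
transpose of a bijection of test functions, so nothing is lost in either direction.

Uniqueness of the kernel (`kernelOp_injective`). A distribution vanishing on all `g ⊗ f` vanishes on
all wave packets `e^{i⟨x, ξ⟩} e^{-|x - y|²/2}`, because a wave packet on a product splits as a
tensor product. Wave packets determine a distribution (`dual_eq_zero_of_wavePackets`): by Fourier
inversion `f(x) e^{-|x - y|²/2}` is an integral over `ξ` of wave packets centred at `y`, and
integrating over `y` gives back a nonzero multiple of `f`.

The analytic point is that a distribution may be moved inside these integrals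
(`dual_apply_integral_slice`). The weighted derivatives `x^β ∂^α f(x)` embed `S_{1/2,h}`
isometrically into a space of bounded families. There the integrals are Bochner integrals, and the
distribution extends to a continuous functional by Hahn–Banach. The test functions needed are built
from Gaussians, so the Gaussian itself has to be shown to lie in `S_{1/2}` (`jb_gaussianFun`). -/

/-! ### Slices -/

/-- The slice `x ↦ Φ(x, y)`. -/
def sliceFun (Φ : (ι ⊕ κ → ℝ) → ℂ) (y : κ → ℝ) : (ι → ℝ) → ℂ := fun x => Φ (Sum.elim x y)

lemma hasFDerivAt_elim_left (x : ι → ℝ) (y : κ → ℝ) :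
    HasFDerivAt (fun x : ι → ℝ => (Sum.elim x y : ι ⊕ κ → ℝ))
      (ContinuousLinearMap.pi (Sum.elim (fun a : ι =>
        (ContinuousLinearMap.proj a : (ι → ℝ) →L[ℝ] ℝ)) fun _ => 0)) x := by
  rw [hasFDerivAt_pi']
  intro j
  cases j with
  | inl a => exact (ContinuousLinearMap.proj a : (ι → ℝ) →L[ℝ] ℝ).hasFDerivAt
  | inr b => exact hasFDerivAt_const _ _

lemma hasFDerivAt_elim_right (x : ι → ℝ) (y : κ → ℝ) :
    HasFDerivAt (fun y : κ → ℝ => (Sum.elim x y : ι ⊕ κ → ℝ))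
      (ContinuousLinearMap.pi (Sum.elim (fun _ : ι => 0) fun b : κ =>
        (ContinuousLinearMap.proj b : (κ → ℝ) →L[ℝ] ℝ))) y := by
  rw [hasFDerivAt_pi']
  intro j
  cases j with
  | inl a => exact hasFDerivAt_const _ _
  | inr b => exact (ContinuousLinearMap.proj b : (κ → ℝ) →L[ℝ] ℝ).hasFDerivAt

lemma contDiff_slice {Φ : (ι ⊕ κ → ℝ) → ℂ} (hΦ : ContDiff ℝ ∞ Φ) (y : κ → ℝ) :
    ContDiff ℝ ∞ (sliceFun Φ y) := by
  refine hΦ.comp (contDiff_pi.2 fun j => ?_)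
  cases j with
  | inl a => exact contDiff_apply ℝ ℝ a
  | inr b => exact contDiff_const

lemma pderiv_slice {Φ : (ι ⊕ κ → ℝ) → ℂ} (hΦ : ContDiff ℝ ∞ Φ) (y : κ → ℝ) (j : ι) :
    pderiv j (sliceFun Φ y) = sliceFun (pderiv (.inl j) Φ) y := by
  funext x
  have h : HasFDerivAt (sliceFun Φ y) _ x :=
    (hΦ.differentiable (by simp) (Sum.elim x y)).hasFDerivAt.comp x (hasFDerivAt_elim_left x y)
  rw [pderiv, h.fderiv, ContinuousLinearMap.comp_apply, sliceFun, pderiv]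
  congr 1
  funext j
  cases j <;> simp [Pi.single_apply]

lemma iter_slice {Φ : (ι ⊕ κ → ℝ) → ℂ} (hΦ : ContDiff ℝ ∞ Φ) (y : κ → ℝ) (α : List ι) :
    iterPderiv α (sliceFun Φ y) = sliceFun (iterPderiv (α.map .inl) Φ) y := by
  induction α with
  | nil => rfl
  | cons a l ih =>
    rw [iter_cons, ih, pderiv_slice (contDiff_iter _ hΦ)]
    rfl

lemma JB.iter {N : ℕ} {h M : ℝ} {f : (ι → ℝ) → ℂ} (α : List ι) (H : JB N h M f) :
    JB (N + α.length) h (h ^ α.length * M) (iterPderiv α f) := by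
  induction α with
  | nil => simpa [iterPderiv] using H
  | cons a l ih =>
    have := ih.pderiv a
    rw [← mul_assoc, ← pow_succ'] at this
    exact this

/-- The slices of a function decay in the parameter. -/
lemma JB.slice {N : ℕ} {h M : ℝ} {Φ : (ι ⊕ κ → ℝ) → ℂ} (H : JB N h M Φ) (h1 : 1 ≤ h)
    (y : κ → ℝ) : JB (N + 2 * Fintype.card κ) h
      (2 ^ Fintype.card κ * h ^ (2 * Fintype.card κ) * M * wt y) (sliceFun Φ y) := by
  refine ⟨contDiff_slice H.1 y, fun α β x => ?_⟩
  rw [iter_slice H.1]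
  have hM := H.nonneg
  set P := |∏ j, x j ^ β j| * ‖iterPderiv (α.map .inl) Φ (Sum.elim x y)‖
  set n := α.length + ∑ j, β j
  -- Expanding the product over subsets `t` gives `2 ^ card κ` terms. Each `∏_{j ∈ t} y_j²` is a
  -- monomial of degree at most `2 * card κ`, which the bound on `Φ` absorbs as extra exponents;
  -- this is where the shift of `N` comes from.
  have key : (∏ j, (1 + y j ^ 2)) * P ≤ 2 ^ Fintype.card κ *
      (M * (h ^ (2 * Fintype.card κ + n) * √((n + (N + 2 * Fintype.card κ))! : ℝ))) := by
    rw [Finset.prod_one_add, Finset.sum_mul]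
    have : ∀ t ∈ (Finset.univ : Finset κ).powerset, (∏ j ∈ t, y j ^ 2) * P ≤
        M * (h ^ (2 * Fintype.card κ + n) * √((n + (N + 2 * Fintype.card κ))! : ℝ)) := by
      intro t _
      have h2 := H.2 (α.map .inl) (Sum.elim β fun j => if j ∈ t then 2 else 0) (Sum.elim x y)
      have e1 : ∏ j, (Sum.elim x y j) ^ ((Sum.elim β fun j => if j ∈ t then 2 else 0 :
          ι ⊕ κ → ℕ) j) = (∏ j, x j ^ β j) * ∏ j ∈ t, y j ^ 2 := by
        rw [Fintype.prod_sum_type]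
        simp [pow_ite, Finset.prod_ite_mem]
      have e2 : ∑ j, (Sum.elim β fun j => if j ∈ t then 2 else 0 : ι ⊕ κ → ℕ) j =
          ∑ j, β j + 2 * t.card := by
        rw [Fintype.sum_sum_type]
        simp [Finset.sum_ite_mem, mul_comm]
      rw [e1, e2, abs_mul, abs_of_nonneg (Finset.prod_nonneg fun j (_ : j ∈ t) => sq_nonneg (y j)),
        mul_right_comm, mul_comm, List.length_map, ← add_assoc] at h2
      refine h2.trans ?_
      have ht : t.card ≤ Fintype.card κ := Finset.card_le_univ t
      rw [show α.length + ∑ j, β j + 2 * t.card + N = n + (N + 2 * t.card) by ring,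
        show α.length + ∑ j, β j + 2 * t.card = 2 * t.card + n by ring]
      gcongr
    refine (Finset.sum_le_card_nsmul _ _ _ this).trans (le_of_eq ?_)
    rw [Finset.card_powerset, Finset.card_univ, nsmul_eq_mul]
    push_cast; ring
  have hpos : 0 < ∏ j, (1 + y j ^ 2) := Finset.prod_pos fun _ _ => by positivity
  calc P = (∏ j, (1 + y j ^ 2)) * P * wt y := by
        rw [wt, Finset.prod_inv_distrib]; field_simp
    _ ≤ _ := mul_le_mul_of_nonneg_right key (wt_pos y).le
    _ = _ := by rw [pow_add]; ring

/-- Since `(m + N)! ≤ 2^(m + N) m! N!`, a shift of the factorial costs only a constant and an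
exponential in `m`, and the latter is absorbed by enlarging `h`. So shifts are harmless in the union
over `h`. -/
lemma JB.shift {N : ℕ} {h M : ℝ} {f : (ι → ℝ) → ℂ} (H : JB N h M f) (h0 : 0 ≤ h) :
    JB 0 (2 * h) (√((2 ^ N * N ! : ℕ) : ℝ) * M) f := by
  refine ⟨H.1, fun α β x => (H.2 α β x).trans ?_⟩
  have hM := H.nonneg
  set m := α.length + ∑ j, β j
  have hf : √((m + N)! : ℝ) ≤ 2 ^ m * √((2 ^ N * N ! : ℕ) : ℝ) * √(m ! : ℝ) := by
    rw [← Real.sqrt_sq (show (0 : ℝ) ≤ 2 ^ m by positivity),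
      ← Real.sqrt_mul (by positivity), ← Real.sqrt_mul (by positivity)]
    apply Real.sqrt_le_sqrt
    have h5 : (m + N)! ≤ (2 ^ m) ^ 2 * (2 ^ N * N !) * m ! := by
      refine (factorial_add_le m N).trans ?_
      rw [pow_add]
      have : 2 ^ m ≤ (2 ^ m) ^ 2 := Nat.le_self_pow two_ne_zero _
      calc 2 ^ m * 2 ^ N * (m ! * N !) ≤ (2 ^ m) ^ 2 * 2 ^ N * (m ! * N !) := by gcongr
        _ = _ := by ring
    exact_mod_cast h5
  calc _ ≤ M * (h ^ m * (2 ^ m * √((2 ^ N * N ! : ℕ) : ℝ) * √(m ! : ℝ))) := by gcongr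
    _ = _ := by rw [mul_pow, add_zero]; ring

lemma JB.mem_space {N : ℕ} {h M : ℝ} {f : (ι → ℝ) → ℂ} (H : JB N h M f) (h1 : 1 ≤ h) :
    f ∈ Space (1 / 2) ι :=
  ⟨H.1, _, by positivity, _, (H.shift (by positivity)).normLE (by positivity)⟩

lemma exists_jb (f : Space (1 / 2) ι) : ∃ h M, 1 ≤ h ∧ JB 0 h M (f : (ι → ℝ) → ℂ) := by
  obtain ⟨hc, h, h0, C, H⟩ := f.2
  exact ⟨max 1 h, C, le_max_left _ _, (H.mono h0.le (le_max_right _ _)).jb hc (by positivity)⟩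

/-- The slice `x ↦ Φ(x, y)` of a test function. -/
def slice (Φ : Space (1 / 2) (ι ⊕ κ)) (y : κ → ℝ) : Space (1 / 2) ι :=
  ⟨sliceFun Φ y, by
    obtain ⟨h, M, h1, H⟩ := exists_jb Φ
    exact (H.slice h1 y).mem_space h1⟩

lemma slice_apply (Φ : Space (1 / 2) (ι ⊕ κ)) (y : κ → ℝ) (x : ι → ℝ) :
    (slice Φ y : (ι → ℝ) → ℂ) x = (Φ : (ι ⊕ κ → ℝ) → ℂ) (Sum.elim x y) := rfl

/-- The slice `y ↦ Φ(x, y)` of a test function. -/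
def sliceRight (Φ : Space (1 / 2) (ι ⊕ κ)) (x : ι → ℝ) : Space (1 / 2) κ :=
  slice (compLin (LinearEquiv.funCongrLeft ℝ ℝ (Equiv.sumComm ι κ)) Φ) x

lemma sliceRight_apply (Φ : Space (1 / 2) (ι ⊕ κ)) (x : ι → ℝ) (y : κ → ℝ) :
    (sliceRight Φ x : (κ → ℝ) → ℂ) y = (Φ : (ι ⊕ κ → ℝ) → ℂ) (Sum.elim x y) := by
  refine congrArg (Φ : (ι ⊕ κ → ℝ) → ℂ) ?_
  funext j
  cases j <;> rfl

lemma continuous_coe (f : Space (1 / 2) ι) : Continuous (f : (ι → ℝ) → ℂ) := f.2.1.continuous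

lemma integrable_coe (f : Space (1 / 2) ι) : Integrable (f : (ι → ℝ) → ℂ) := by
  -- Regarded on `ℝ^0 × ℝ^n`, `f` has an integrable Fourier integrand; at frequency 0 the
  -- exponential is 1.
  have := (nice_of_mem (compLin (emptySum ι) f).2).integrable 1 0 0
  refine this.congr (Filter.Eventually.of_forall fun y => ?_)
  simp only [ker, dotProduct_zero, Complex.ofReal_zero, mul_zero, Complex.exp_zero, mul_one]
  rfl

/-! ### Fourier inversion -/

lemma fourier_apply (σ : ℤˣ) (f : Space (1 / 2) ι) (ξ : ι → ℝ) :
    (fourier σ f : (ι → ℝ) → ℂ) ξ = ((2 * Real.pi) ^ (-(Fintype.card ι : ℝ) / 2) : ℝ) *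
      ∫ x : ι → ℝ, (f : (ι → ℝ) → ℂ) x * ker σ x ξ := rfl

lemma partialFourier_apply (σ : ℤˣ) (f : Space (1 / 2) (ι ⊕ κ)) (x : ι → ℝ) (ξ : κ → ℝ) :
    (partialFourier σ f : (ι ⊕ κ → ℝ) → ℂ) (Sum.elim x ξ) =
      (fourier σ (sliceRight f x) : (κ → ℝ) → ℂ) ξ := by
  rw [fourier_apply]
  simp only [sliceRight_apply]
  rfl

/-- The first variable is a mere parameter, so inversion for the partial transform reduces to
inversion on each slice. -/
lemma sliceRight_partialFourier (σ : ℤˣ) (f : Space (1 / 2) (ι ⊕ κ)) (x : ι → ℝ) :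
    sliceRight (partialFourier σ f) x = fourier σ (sliceRight f x) := by
  apply Subtype.ext
  funext ξ
  rw [sliceRight_apply, partialFourier_apply]

lemma ker_neg_left (σ : ℤˣ) (x ξ : ι → ℝ) : ker σ (-x) ξ = ker (-σ) x ξ := by
  simp [ker]

lemma ker_neg_right (σ : ℤˣ) (x ξ : ι → ℝ) : ker σ x (-ξ) = ker (-σ) x ξ := by
  simp [ker]

lemma fourier_neg_apply (σ : ℤˣ) (f : Space (1 / 2) ι) (ξ : ι → ℝ) :
    (fourier (-σ) f : (ι → ℝ) → ℂ) ξ = (fourier σ f : (ι → ℝ) → ℂ) (-ξ) := by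
  simp only [fourier_apply, ker_neg_right]

lemma integral_toLp {E : Type*} [NormedAddCommGroup E] [NormedSpace ℝ E]
    (g : EuclideanSpace ℝ ι → E) : ∫ v, g v = ∫ x : ι → ℝ, g (WithLp.toLp 2 x) :=
  ((EuclideanSpace.volume_preserving_symm_measurableEquiv_toLp ι).symm.integral_comp'
    (g := g)).symm

-- Conversion of normalisations: Mathlib's `𝓕` has phase `-2πi⟨v, w⟩` and no prefactor, so the
-- frequency is dilated by `2π` and the factor `(2π)^{-n/2}` is undone.
open FourierTransform in
lemma fourier_ofLp (f : Space (1 / 2) ι) (v : EuclideanSpace ℝ ι) :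
    𝓕 (fun v : EuclideanSpace ℝ ι => (f : (ι → ℝ) → ℂ) v.ofLp) v =
      (((2 * Real.pi) ^ ((Fintype.card ι : ℝ) / 2) : ℝ) : ℂ) *
        (fourier (-1) f : (ι → ℝ) → ℂ) ((2 * Real.pi) • v.ofLp) := by
  rw [Real.fourier_eq', integral_toLp, fourier_apply, ← mul_assoc, ← Complex.ofReal_mul,
    ← Real.rpow_add (by positivity), neg_div, add_neg_cancel, Real.rpow_zero, Complex.ofReal_one,
    one_mul]
  congr 1
  funext x
  rw [smul_eq_mul, mul_comm]
  congr 1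
  rw [ker, EuclideanSpace.inner_eq_star_dotProduct, dotProduct_comm, dotProduct_smul]
  congr 1
  simp
  ring

-- Mathlib's inversion theorem, applicable because `f` is continuous and both `f` and its transform,
-- again a test function, are integrable. Only the rescaling by `2π` has to be followed.
open FourierTransform in
lemma fourier_one_fourier_neg_one (f : Space (1 / 2) ι) : fourier 1 (fourier (-1) f) = f := by
  set F : EuclideanSpace ℝ ι → ℂ := fun v => (f : (ι → ℝ) → ℂ) v.ofLp
  have mp := EuclideanSpace.volume_preserving_symm_measurableEquiv_toLp ι
  have c1 : Continuous F := (continuous_coe f).comp (PiLp.continuous_ofLp 2 _)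
  have i1 : Integrable F := mp.integrable_comp_of_integrable (integrable_coe f)
  have hF : 𝓕 F = fun v => (((2 * Real.pi) ^ ((Fintype.card ι : ℝ) / 2) : ℝ) : ℂ) *
        (fourier (-1) f : (ι → ℝ) → ℂ) ((2 * Real.pi) • v.ofLp) := funext (fourier_ofLp f)
  have i2 : Integrable (𝓕 F) := by
    rw [hF]
    exact (mp.integrable_comp_of_integrable
      ((integrable_coe (fourier (-1) f)).comp_smul (R := 2 * Real.pi) (by positivity))).const_mul _
  have key := c1.fourierInv_fourier_eq i1 i2
  apply Subtype.ext
  funext x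
  have k2 := congrFun key (WithLp.toLp 2 x)
  rw [Real.fourierInv_eq', integral_toLp, hF] at k2
  change _ = (f : (ι → ℝ) → ℂ) x at k2
  rw [← k2, fourier_apply]
  have e := Measure.integral_comp_smul (volume : Measure (ι → ℝ))
    (fun ξ => (fourier (-1) f : (ι → ℝ) → ℂ) ξ * ker 1 ξ x) (2 * Real.pi)
  -- The Jacobian `(2π)^n` of the dilation is split as `c * c`: one factor cancels the prefactor of
  -- `fourier 1`, the other is the constant of `fourier_ofLp`.
  have h2 : ((2 * Real.pi) ^ (Module.finrank ℝ (ι → ℝ)) : ℝ) =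
      (2 * Real.pi) ^ ((Fintype.card ι : ℝ) / 2) * (2 * Real.pi) ^ ((Fintype.card ι : ℝ) / 2) := by
    rw [← Real.rpow_add (by positivity), Module.finrank_fintype_fun_eq_card, add_halves,
      Real.rpow_natCast]
  set c : ℝ := (2 * Real.pi) ^ ((Fintype.card ι : ℝ) / 2)
  have hc : 0 < c := by positivity
  rw [h2, abs_of_pos (by positivity)] at e
  have e3 : ∫ y : ι → ℝ, (fourier (-1) f : (ι → ℝ) → ℂ) y * ker 1 y x = ((c * c : ℝ) : ℂ) *
      ∫ y : ι → ℝ, (fourier (-1) f : (ι → ℝ) → ℂ) ((2 * Real.pi) • y) *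
        ker 1 ((2 * Real.pi) • y) x := by
    rw [e, Complex.real_smul, ← mul_assoc, ← Complex.ofReal_mul, mul_inv_cancel₀ (by positivity)]
    simp
  rw [e3, ← mul_assoc, ← Complex.ofReal_mul, neg_div, Real.rpow_neg (by positivity)]
  change ((c⁻¹ * (c * c) : ℝ) : ℂ) * _ = _
  rw [show c⁻¹ * (c * c) = c by field_simp, ← integral_const_mul]
  congr 1
  funext y
  rw [smul_eq_mul, ker, EuclideanSpace.inner_eq_star_dotProduct, smul_dotProduct,
    dotProduct_comm]
  simp
  ring_nf

lemma fourier_neg_fourier (σ : ℤˣ) (f : Space (1 / 2) ι) : fourier (-σ) (fourier σ f) = f := by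
  rcases Int.units_eq_one_or σ with rfl | rfl
  -- The two orders of composition give the same function, by the substitution `y ↦ -y` in the outer
  -- integral. The rewriting displays `f` on the right as `fourier 1 (fourier (-1) f)`, so that two
  -- outer integrals can be compared.
  · rw [← fourier_one_fourier_neg_one f]
    conv_rhs => rw [← fourier_one_fourier_neg_one f]
    apply Subtype.ext
    funext x
    rw [fourier_apply, fourier_one_fourier_neg_one, fourier_apply]
    congr 1
    rw [← integral_neg_eq_self]
    congr 1
    funext y
    rw [ker_neg_left, neg_neg, ← fourier_neg_apply]
  · rw [neg_neg, fourier_one_fourier_neg_one]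

lemma fourier_fourier_apply (σ : ℤˣ) (f : Space (1 / 2) ι) (x : ι → ℝ) :
    (fourier σ (fourier σ f) : (ι → ℝ) → ℂ) x = (f : (ι → ℝ) → ℂ) (-x) := by
  conv_rhs => rw [← fourier_neg_fourier σ f]
  rw [fourier_neg_apply, neg_neg]

/-! ### Partial Fourier inversion and Fubini -/

lemma ext_sliceRight {f g : Space (1 / 2) (ι ⊕ κ)} (h : ∀ x, sliceRight f x = sliceRight g x) :
    f = g := by
  apply Subtype.ext
  funext w
  have := congrFun (congrArg Subtype.val (h fun a => w (.inl a))) (fun b => w (.inr b))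
  rw [sliceRight_apply, sliceRight_apply] at this
  rwa [show (Sum.elim (fun a => w (.inl a)) fun b => w (.inr b)) = w from
    Sum.elim_comp_inl_inr w] at this

lemma partialFourier_neg_partialFourier (σ : ℤˣ) (f : Space (1 / 2) (ι ⊕ κ)) :
    partialFourier (-σ) (partialFourier σ f) = f :=
  ext_sliceRight fun x => by
    rw [sliceRight_partialFourier, sliceRight_partialFourier, fourier_neg_fourier]

lemma partialFourier_partialFourier_apply (σ : ℤˣ) (f : Space (1 / 2) (ι ⊕ κ)) (x : ι → ℝ)
    (y : κ → ℝ) : (partialFourier σ (partialFourier σ f) : (ι ⊕ κ → ℝ) → ℂ) (Sum.elim x y) =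
      (f : (ι ⊕ κ → ℝ) → ℂ) (Sum.elim x (-y)) := by
  rw [partialFourier_apply, sliceRight_partialFourier, fourier_fourier_apply, sliceRight_apply]

/-- The Fourier transform as an iterated integral. -/
lemma fourier_eq_integral_partialFourier (σ : ℤˣ) (f : Space (1 / 2) (ι ⊕ κ)) (η : ι → ℝ)
    (ζ : κ → ℝ) : (fourier σ f : (ι ⊕ κ → ℝ) → ℂ) (Sum.elim η ζ) =
      ((2 * Real.pi) ^ (-(Fintype.card ι : ℝ) / 2) : ℝ) *
        ∫ u : ι → ℝ, (partialFourier σ f : (ι ⊕ κ → ℝ) → ℂ) (Sum.elim u ζ) * ker σ u η := by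
  have mp := volume_measurePreserving_sumPiEquivProdPi_symm (fun _ : ι ⊕ κ => ℝ)
  have hi : Integrable (fun w : ι ⊕ κ → ℝ => (f : (ι ⊕ κ → ℝ) → ℂ) w * ker σ w (Sum.elim η ζ)) :=
    (integrable_coe f).mul_bdd (c := 1) (continuous_ker σ _).aestronglyMeasurable
      (Filter.Eventually.of_forall fun w => (norm_ker σ _ _).le)
  have hi2 := (mp.integrable_comp_emb (MeasurableEquiv.measurableEmbedding _)).2 hi
  rw [fourier_apply, ← mp.integral_comp (MeasurableEquiv.measurableEmbedding _)]
  have hv : (volume : Measure ((ι → ℝ) × (κ → ℝ))) = volume.prod volume := rfl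
  rw [hv] at hi2 ⊢
  have := integral_prod _ hi2
  simp only [Function.comp_def] at this
  rw [this]
  have hk : ∀ (u : ι → ℝ) (z : κ → ℝ), ker σ (Sum.elim u z) (Sum.elim η ζ) =
      ker σ u η * ker σ z ζ := by
    intro u z
    rw [ker, ker, ker, ← Complex.exp_add, dotProduct, Fintype.sum_sum_type]
    congr 1
    simp [dotProduct]
    ring
  have hc : (((2 * Real.pi) ^ (-(Fintype.card (ι ⊕ κ) : ℝ) / 2) : ℝ) : ℂ) =
      ((2 * Real.pi) ^ (-(Fintype.card ι : ℝ) / 2) : ℝ) *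
        ((2 * Real.pi) ^ (-(Fintype.card κ : ℝ) / 2) : ℝ) := by
    rw [← Complex.ofReal_mul, ← Real.rpow_add (by positivity), Fintype.card_sum]
    congr 2
    push_cast; ring
  rw [hc, mul_assoc, ← integral_const_mul]
  congr 2
  funext u
  rw [partialFourier_apply, fourier_apply, mul_assoc]
  congr 1
  rw [← integral_mul_const]
  congr 1
  funext z
  have e : (MeasurableEquiv.sumPiEquivProdPi (fun _ : ι ⊕ κ => ℝ)).symm (u, z) = Sum.elim u z := by
    funext j; cases j <;> rfl
  rw [e, hk, sliceRight_apply]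
  ring

/-! ### Distributions as functionals on a space of bounded families -/

/-- The space `S_{1/2,h}`. -/
def boundedSpace (h : ℝ) (ι : Type*) [Fintype ι] [DecidableEq ι] :
    Submodule ℂ (Space (1 / 2) ι) where
  carrier := {f | ∃ M, NormLE (1 / 2) h M (f : (ι → ℝ) → ℂ)}
  zero_mem' := ⟨0, fun α β x => by
    -- With constant 0 the right-hand side vanishes whatever the weight, so the values of `N` and
    -- `h` here do not matter.
    have := (JB.zero (ι := ι) (N := 0) (h := 0)).2 α β x
    rw [zero_mul] at this ⊢
    exact this⟩
  add_mem' := by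
    rintro f g ⟨M, H⟩ ⟨M', H'⟩
    exact ⟨M + M', H.add H' f.2.1 g.2.1⟩
  smul_mem' := by
    rintro c f ⟨M, H⟩
    exact ⟨‖c‖ * M, H.smul c f.2.1⟩

/-- The weight of the multi-indices `α` and `β` in the norm of `S_{1/2,h}`. -/
def weight (h : ℝ) (α : List ι) (β : ι → ℕ) : ℝ :=
  h ^ (α.length + ∑ j, β j) * (multiFactorial fun j => α.count j : ℝ) ^ (1 / 2 : ℝ) *
    (multiFactorial β : ℝ) ^ (1 / 2 : ℝ)

lemma multiFactorial_pos (β : ι → ℕ) : 0 < multiFactorial β :=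
  Finset.prod_pos fun _ _ => Nat.factorial_pos _

lemma weight_pos {h : ℝ} (h0 : 0 < h) (α : List ι) (β : ι → ℕ) : 0 < weight h α β := by
  have h1 : (0 : ℝ) < multiFactorial fun j => α.count j := by exact_mod_cast multiFactorial_pos _
  have h2 : (0 : ℝ) < multiFactorial β := by exact_mod_cast multiFactorial_pos _
  unfold weight
  positivity

/-- The value `x^β ∂^α f(x) / (h^{|α| + |β|} α!^{1/2} β!^{1/2})`. -/
def normalized (h : ℝ) (f : (ι → ℝ) → ℂ) (i : List ι × (ι → ℕ) × (ι → ℝ)) : ℂ :=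
  ((∏ j, i.2.2 j ^ i.2.1 j : ℝ) : ℂ) * iterPderiv i.1 f i.2.2 / (weight h i.1 i.2.1 : ℂ)

lemma normLE_iff {h M : ℝ} (h0 : 0 < h) (f : (ι → ℝ) → ℂ) :
    NormLE (1 / 2) h M f ↔ ∀ i, ‖normalized h f i‖ ≤ M := by
  have : ∀ (α : List ι) (β : ι → ℕ) (x : ι → ℝ),
      (‖normalized h f (α, β, x)‖ ≤ M ↔ |∏ j, x j ^ β j| * ‖iterPderiv α f x‖ ≤
        M * weight h α β) := fun α β x => by
    have hw := weight_pos h0 α β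
    rw [normalized, norm_div, norm_mul, Complex.norm_real, Complex.norm_real, Real.norm_eq_abs,
      Real.norm_eq_abs, abs_of_pos hw, div_le_iff₀ hw]
  exact ⟨fun H i => (this _ _ _).2 (H i.1 i.2.1 i.2.2), fun H α β x => (this α β x).1 (H _)⟩

/-- The embedding of `S_{1/2,h}` into a space of bounded families. -/
def boundedEmbedding {h : ℝ} (h0 : 0 < h) :
    boundedSpace h ι →ₗ[ℂ] lp (fun _ : List ι × (ι → ℕ) × (ι → ℝ) => ℂ) ⊤ where
  toFun f := ⟨normalized h (f : Space (1 / 2) ι), memℓp_infty (by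
    obtain ⟨M, H⟩ := f.2
    refine ⟨M, ?_⟩
    rintro _ ⟨i, rfl⟩
    exact (normLE_iff h0 _).1 H i)⟩
  map_add' f g := by
    apply Subtype.ext
    funext i
    change normalized h (((f : Space (1 / 2) ι) : (ι → ℝ) → ℂ) +
      ((g : Space (1 / 2) ι) : (ι → ℝ) → ℂ)) i = normalized h _ i + normalized h _ i
    rw [normalized, iter_add _ f.1.2.1 g.1.2.1, Pi.add_apply, mul_add, add_div]
    rfl
  map_smul' c f := by
    apply Subtype.ext
    funext i
    change normalized h (c • ((f : Space (1 / 2) ι) : (ι → ℝ) → ℂ)) i = c • normalized h _ i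
    rw [normalized, iter_smul _ _ f.1.2.1, Pi.smul_apply, smul_eq_mul, smul_eq_mul, mul_left_comm,
      mul_div_assoc]
    rfl

lemma norm_boundedEmbedding_le {h M : ℝ} (h0 : 0 < h) (f : boundedSpace h ι)
    (H : NormLE (1 / 2) h M ((f : Space (1 / 2) ι) : (ι → ℝ) → ℂ)) :
    ‖boundedEmbedding h0 f‖ ≤ M :=
  lp.norm_le_of_forall_le H.nonneg ((normLE_iff h0 _).1 H)

/-- With `norm_boundedEmbedding_le` this shows that the supremum norm of the family is the least
admissible `M`, so the embedding is isometric for the norm of `S_{1/2,h}`. -/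
lemma normLE_norm_boundedEmbedding {h : ℝ} (h0 : 0 < h) (f : boundedSpace h ι) :
    NormLE (1 / 2) h ‖boundedEmbedding h0 f‖ ((f : Space (1 / 2) ι) : (ι → ℝ) → ℂ) :=
  (normLE_iff h0 _).2 fun i => lp.norm_apply_le_norm (by simp) (boundedEmbedding h0 f) i

lemma boundedEmbedding_injective {h : ℝ} (h0 : 0 < h) :
    Function.Injective (boundedEmbedding h0 : boundedSpace h ι →ₗ[ℂ] _) := by
  rw [injective_iff_map_eq_zero]
  intro f hf
  have H := normLE_norm_boundedEmbedding h0 f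
  rw [hf, norm_zero] at H
  apply Subtype.ext
  apply Subtype.ext
  funext x
  have := H [] 0 x
  simpa [iterPderiv] using this

/-- A distribution extends to a bounded functional on the space of bounded families. -/
lemma exists_extension (K : Dual (1 / 2) ι) {h : ℝ} (h0 : 0 < h) :
    ∃ L : lp (fun _ : List ι × (ι → ℕ) × (ι → ℝ) => ℂ) ⊤ →L[ℂ] ℂ, ∀ f : boundedSpace h ι,
      L (boundedEmbedding h0 f) = (K : Space (1 / 2) ι →ₗ[ℂ] ℂ) f := by
  obtain ⟨C, H⟩ := K.2 h h0
  -- The functional is carried to the range of the embedding, where the defining estimate of `Dual`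
  -- is boundedness in the ambient norm; Hahn–Banach then extends it.
  let e := LinearEquiv.ofInjective _ (boundedEmbedding_injective (ι := ι) h0)
  have he : ∀ f, (e f : lp (fun _ : List ι × (ι → ℕ) × (ι → ℝ) => ℂ) ⊤) = boundedEmbedding h0 f :=
    fun f => rfl
  let u : LinearMap.range (boundedEmbedding (ι := ι) h0) →ₗ[ℂ] ℂ :=
    (K : Space (1 / 2) ι →ₗ[ℂ] ℂ) ∘ₗ (boundedSpace h ι).subtype ∘ₗ e.symm.toLinearMap
  obtain ⟨L, hL, -⟩ := exists_extension_norm_eq _ (u.mkContinuous C fun v => by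
    obtain ⟨f, rfl⟩ := e.surjective v
    change ‖(K : Space (1 / 2) ι →ₗ[ℂ] ℂ) (e.symm (e f) : boundedSpace h ι)‖ ≤ _
    rw [e.symm_apply_apply]
    exact H _ _ (normLE_norm_boundedEmbedding h0 f))
  refine ⟨L, fun f => ?_⟩
  rw [← he, hL]
  change (K : Space (1 / 2) ι →ₗ[ℂ] ℂ) (e.symm (e f) : boundedSpace h ι) = _
  rw [e.symm_apply_apply]

/-! ### Distributions commute with integrals of slices -/

lemma Nice.iter {g : (ι → ℝ) → ℂ} (H : Nice g) (α : List ι) : Nice (iterPderiv α g) := by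
  obtain ⟨N, h, M, h1, H⟩ := H
  exact ⟨_, _, _, h1, H.iter α⟩

/-- The integral over `y` is the Fourier integral at frequency 0, whose differentiability under the
integral sign is already known; the chain rule restricts it to the first variable. -/
lemma pderiv_integral_slice {g : (ι ⊕ κ → ℝ) → ℂ} (H : Nice g) (a : ι) :
    pderiv a (fun x => ∫ y, g (Sum.elim x y)) =
      fun x => ∫ y, pderiv (.inl a) g (Sum.elim x y) := by
  funext x
  have h1 := HasFDerivAt.comp (f := fun x : ι → ℝ => (Sum.elim x 0 : ι ⊕ κ → ℝ)) x
    (hasFDerivAt_integral H 1 (Sum.elim x 0)) (hasFDerivAt_elim_left x 0)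
  have e : (fun w : ι ⊕ κ → ℝ => ∫ y, g (Sum.elim (fun a => w (.inl a)) y) *
      ker 1 y (fun b => w (.inr b))) ∘ (fun x : ι → ℝ => (Sum.elim x 0 : ι ⊕ κ → ℝ)) =
      fun x => ∫ y, g (Sum.elim x y) := by
    funext x
    have : ∀ y : κ → ℝ, ker 1 y (fun _ => 0) = 1 := fun y => by
      rw [ker, show (fun _ : κ => (0 : ℝ)) = 0 from rfl]; simp
    simp [this]
  rw [e] at h1
  rw [pderiv, h1.fderiv, ContinuousLinearMap.comp_apply,
    ContinuousLinearMap.integral_apply (integrable_dker H 1 _)]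
  congr 1
  funext y
  have : ker 1 y (fun _ => 0) = 1 := by
    rw [ker, show (fun _ : κ => (0 : ℝ)) = 0 from rfl]; simp
  simp [dker, _root_.sum_apply, Pi.single_apply, this]

lemma iter_integral_slice {g : (ι ⊕ κ → ℝ) → ℂ} (H : Nice g) (α : List ι) :
    iterPderiv α (fun x => ∫ y, g (Sum.elim x y)) =
      fun x => ∫ y, iterPderiv (α.map .inl) g (Sum.elim x y) := by
  induction α with
  | nil => rfl
  | cons a l ih =>
    rw [iter_cons, ih, pderiv_integral_slice (H.iter _)]
    rfl

/-- Mean value inequality in the parameter: one further derivative in a `κ` direction costs one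
power of `h` and one step in `N`, and there are `card κ` directions. It makes slices Lipschitz,
hence measurable, in `y`. -/
lemma JB.slice_sub {N : ℕ} {h M : ℝ} {Φ : (ι ⊕ κ → ℝ) → ℂ} (H : JB N h M Φ) (h0 : 0 ≤ h)
    (y y' : κ → ℝ) : JB (N + 1) h (Fintype.card κ * (h * M) * ‖y - y'‖)
      (sliceFun Φ y - sliceFun Φ y') := by
  refine ⟨(contDiff_slice H.1 y).sub (contDiff_slice H.1 y'), fun α β x => ?_⟩
  have hM := H.nonneg
  set n := α.length + ∑ j, β j
  have e : sliceFun Φ y - sliceFun Φ y' = sliceFun Φ y + (-1 : ℂ) • sliceFun Φ y' := by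
    rw [neg_one_smul, sub_eq_add_neg]
  have hc : ContDiff ℝ ∞ ((-1 : ℂ) • sliceFun Φ y') :=
    contDiff_const.smul (contDiff_slice H.1 y')
  rw [e, iter_add α (contDiff_slice H.1 y) hc,
    iter_smul _ α (contDiff_slice H.1 y'), neg_one_smul, ← sub_eq_add_neg, iter_slice H.1,
    iter_slice H.1]
  set g := iterPderiv (α.map Sum.inl) Φ
  have hg : ContDiff ℝ ∞ g := contDiff_iter _ H.1
  set P : ℝ := |∏ j, x j ^ β j|
  -- The monomial weight `P` does not depend on `y`; kept inside the function, it lets the bound on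
  -- `Φ` apply directly to the derivative.
  have hd : ∀ y, HasFDerivAt (fun y => (P : ℂ) * g (Sum.elim x y)) _ y := fun y =>
    ((hg.differentiable (by simp) (Sum.elim x y)).hasFDerivAt.comp y
      (hasFDerivAt_elim_right x y)).const_mul (P : ℂ)
  have hb : ∀ y, ‖fderiv ℝ (fun y => (P : ℂ) * g (Sum.elim x y)) y‖ ≤
      Fintype.card κ * (M * (h ^ (n + 1) * √((n + (N + 1))! : ℝ))) := by
    intro y
    refine ContinuousLinearMap.opNorm_le_bound _ (by positivity) fun v => ?_
    rw [(hd y).fderiv, _root_.smul_apply, ContinuousLinearMap.comp_apply, fderiv_eq_sum,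
      Fintype.sum_sum_type]
    simp only [ContinuousLinearMap.coe_pi', Sum.elim_inl, Sum.elim_inr, _root_.zero_apply,
      Complex.ofReal_zero, zero_mul, Finset.sum_const_zero, zero_add, smul_eq_mul, Finset.mul_sum,
      ContinuousLinearMap.proj_apply]
    refine (norm_sum_le_of_le _ (f := fun b => (P : ℂ) * ((v b : ℂ) *
      GelfandShilov.pderiv (.inr b) g (Sum.elim x y))) (n := fun _ => M * (h ^ (n + 1) *
        √((n + (N + 1))! : ℝ)) * ‖v‖) fun b _ => ?_).trans (le_of_eq ?_)
    · have := H.2 (.inr b :: α.map .inl) (Sum.elim β 0) (Sum.elim x y)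
      rw [iter_cons, Fintype.prod_sum_type, Fintype.sum_sum_type] at this
      simp only [Sum.elim_inl, Sum.elim_inr, Pi.zero_apply, pow_zero, Finset.prod_const_one,
        mul_one, Finset.sum_const_zero, add_zero, List.length_cons, List.length_map] at this
      rw [show α.length + 1 + ∑ j, β j = n + 1 by ring, add_right_comm n 1 N, add_assoc n] at this
      rw [norm_mul, norm_mul, Complex.norm_real, Complex.norm_real, mul_left_comm, mul_comm,
        Real.norm_eq_abs P, abs_of_nonneg (abs_nonneg _)]
      exact mul_le_mul this (norm_le_pi_norm v b) (norm_nonneg _) (by positivity)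
    · rw [Finset.sum_const, Finset.card_univ, nsmul_eq_mul]
      ring
  have := Convex.norm_image_sub_le_of_norm_fderiv_le (𝕜 := ℝ) (fun y _ => (hd y).differentiableAt)
    (fun y _ => hb y) convex_univ (Set.mem_univ y') (Set.mem_univ y)
  rw [← mul_sub, norm_mul, Complex.norm_real, Real.norm_eq_abs P, abs_of_nonneg (abs_nonneg _)]
    at this
  refine this.trans (le_of_eq ?_)
  rw [pow_succ]
  ring

/-- All slices lie in a single `S_{1/2,p}`, depend on `y` in a Lipschitz way and are dominated in
norm by a multiple of `wt y`. Hence their embedded family is Bochner integrable, and the continuous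
extension of `K` commutes with its integral. -/
lemma dual_apply_integral_slice (K : Dual (1 / 2) ι) (Φ : Space (1 / 2) (ι ⊕ κ))
    (f : Space (1 / 2) ι)
    (hf : ∀ x, (f : (ι → ℝ) → ℂ) x = ∫ y, (Φ : (ι ⊕ κ → ℝ) → ℂ) (Sum.elim x y)) :
    (K : Space (1 / 2) ι →ₗ[ℂ] ℂ) f = ∫ y, (K : Space (1 / 2) ι →ₗ[ℂ] ℂ) (slice Φ y) := by
  obtain ⟨h, M, h1, H⟩ := exists_jb Φ
  obtain ⟨-, k, k0, M', H'⟩ := f.2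
  have hM := H.nonneg
  -- `k` accommodates `f`; in the other term, `2 * h` comes from `JB.shift` and the factor `2 * 2 ^
  -- card ι` from `JB.normLE`.
  set p := max k (2 * 2 ^ Fintype.card ι * (2 * h))
  have p0 : 0 < p := lt_max_of_lt_left k0
  have hjb : ∀ {N : ℕ} {C : ℝ} {g : (ι → ℝ) → ℂ}, JB N h C g →
      NormLE (1 / 2) p (√((2 ^ N * N ! : ℕ) : ℝ) * C) g := fun hg =>
    ((hg.shift (by positivity)).normLE (by positivity)).mono (by positivity) (le_max_right _ _)
  have hs := fun y => hjb (H.slice h1 y)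
  have hsub := fun y y' => hjb (H.slice_sub (by positivity) y y')
  obtain ⟨L, hL⟩ := exists_extension K p0
  let f' : boundedSpace p ι := ⟨f, M', H'.mono k0.le (le_max_left _ _)⟩
  let s : (κ → ℝ) → boundedSpace p ι := fun y => ⟨slice Φ y, _, hs y⟩
  let F := fun y => boundedEmbedding p0 (s y)
  have hF : LipschitzWith (Real.toNNReal (√((2 ^ (0 + 1) * (0 + 1)! : ℕ) : ℝ) *
      (Fintype.card κ * (h * M)))) F := by
    refine LipschitzWith.of_dist_le_mul fun y y' => ?_
    rw [Real.coe_toNNReal _ (by positivity), dist_eq_norm, dist_eq_norm, mul_assoc]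
    change ‖boundedEmbedding p0 (s y) - boundedEmbedding p0 (s y')‖ ≤ _
    rw [← map_sub]
    exact norm_boundedEmbedding_le p0 _ (hsub y y')
  have hi : Integrable F := by
    refine Integrable.mono' (integrable_wt.const_mul _) hF.continuous.aestronglyMeasurable
      (Filter.Eventually.of_forall fun y => (norm_boundedEmbedding_le p0 _ (hs y)).trans
        (le_of_eq (mul_assoc _ _ _).symm))
  -- Evaluation at an index is continuous on bounded families, so the identity is checked coordinate
  -- by coordinate, where it is differentiation under the integral sign.
  have hint : ∫ y, F y = boundedEmbedding p0 f' := by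
    apply Subtype.ext
    funext i
    have he := (lp.evalCLM ℂ (fun _ : List ι × (ι → ℕ) × (ι → ℝ) => ℂ) ⊤ i).integral_comp_comm hi
    refine he.symm.trans ?_
    change ∫ y, normalized p (sliceFun (Φ : (ι ⊕ κ → ℝ) → ℂ) y) i = normalized p f i
    have e2 : (f : (ι → ℝ) → ℂ) = fun x => ∫ y, (Φ : (ι ⊕ κ → ℝ) → ℂ) (Sum.elim x y) := funext hf
    simp only [normalized]
    rw [e2, iter_integral_slice (nice_of_mem Φ.2), ← integral_const_mul, ← integral_div]
    simp only [iter_slice Φ.2.1]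
    rfl
  have e1 : (K : Space (1 / 2) ι →ₗ[ℂ] ℂ) f = L (boundedEmbedding p0 f') := (hL f').symm
  rw [e1, ← hint, ← L.integral_comp_comm hi]
  congr 1
  funext y
  exact hL (s y)

/-! ### Gaussians -/

/-- The Gaussian `e^{-|x|^2 / 2}`. -/
def gaussianFun (x : ι → ℝ) : ℂ := (Real.exp (-(x ⬝ᵥ x) / 2) : ℝ)

lemma gaussianFun_ne_zero (x : ι → ℝ) : gaussianFun x ≠ 0 := by
  rw [gaussianFun, Complex.ofReal_ne_zero]
  exact (Real.exp_pos _).ne'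

lemma contDiff_gaussianFun : ContDiff ℝ ∞ (gaussianFun : (ι → ℝ) → ℂ) := by
  refine Complex.ofRealCLM.contDiff.comp (Real.contDiff_exp.comp (ContDiff.div_const ?_ _))
  unfold dotProduct
  exact (ContDiff.sum fun j _ => (contDiff_apply ℝ ℝ j).mul (contDiff_apply ℝ ℝ j)).neg

lemma pderiv_gaussianFun (j : ι) :
    pderiv j (gaussianFun : (ι → ℝ) → ℂ) = (-1 : ℂ) • mulX j gaussianFun := by
  funext x
  have h0 : HasFDerivAt (fun x : ι → ℝ => -(x ⬝ᵥ x) / 2)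
      ((2 : ℝ)⁻¹ • -∑ i, (x i • (ContinuousLinearMap.proj i : (ι → ℝ) →L[ℝ] ℝ) +
        x i • (ContinuousLinearMap.proj i : (ι → ℝ) →L[ℝ] ℝ))) x := by
    simp_rw [div_eq_inv_mul]
    refine HasFDerivAt.const_mul ?_ _
    unfold dotProduct
    exact (HasFDerivAt.fun_sum fun i _ => (hasFDerivAt_coord i x).mul (hasFDerivAt_coord i x)).neg
  have h1 : HasFDerivAt (gaussianFun : (ι → ℝ) → ℂ) _ x :=
    Complex.ofRealCLM.hasFDerivAt.comp x h0.exp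
  rw [pderiv, h1.fderiv]
  simp [_root_.sum_apply, Pi.single_apply, mulX, gaussianFun, Finset.sum_add_distrib]
  ring

/-- Square root of `(t²)^b / b! ≤ e^{t²}`: one term of the exponential series. This is why Gaussians
fit the order `1/2`. -/
lemma abs_pow_mul_exp_le (t : ℝ) (b : ℕ) : |t ^ b| * Real.exp (-(t * t) / 2) ≤ √(b ! : ℝ) := by
  apply Real.le_sqrt_of_sq_le
  have h := Real.pow_div_factorial_le_exp (t * t) (mul_self_nonneg t) b
  rw [div_le_iff₀ (by positivity)] at h
  rw [mul_pow, sq_abs, ← Real.exp_nat_mul, show ((2 : ℕ) : ℝ) * (-(t * t) / 2) = -(t * t) by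
    push_cast; ring, Real.exp_neg, ← div_eq_mul_inv, div_le_iff₀ (Real.exp_pos _)]
  calc (t ^ b) ^ 2 = (t * t) ^ b := by rw [← pow_mul, mul_comm b 2, pow_mul, sq]
    _ ≤ _ := by linarith

lemma abs_prod_mul_gaussianFun_le (β : ι → ℕ) (x : ι → ℝ) :
    |∏ j, x j ^ β j| * ‖gaussianFun x‖ ≤ √((∑ j, β j)! : ℝ) := by
  have e : ‖gaussianFun x‖ = ∏ j, Real.exp (-(x j * x j) / 2) := by
    rw [gaussianFun, Complex.norm_real, Real.norm_eq_abs, abs_of_pos (Real.exp_pos _),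
      ← Real.exp_sum, dotProduct, ← Finset.sum_div, Finset.sum_neg_distrib]
  rw [e, Finset.abs_prod, ← Finset.prod_mul_distrib]
  calc _ ≤ ∏ j, √((β j)! : ℝ) := Finset.prod_le_prod (fun j _ => by positivity)
        fun j _ => abs_pow_mul_exp_le (x j) (β j)
    _ = √((multiFactorial β : ℕ) : ℝ) := by
        rw [multiFactorial, Nat.cast_prod, ← Real.sqrt_prod _ fun _ _ => by positivity]
    _ ≤ _ := Real.sqrt_le_sqrt (by exact_mod_cast multiFactorial_le β)

/-- Induction on the order of differentiation. As `∂_j` of the Gaussian is `-x_j` times it,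
commuting `x_j` past the remaining derivatives leaves a term of order one less with a higher
monomial, and commutator terms of order two less. Each group obeys half of the bound, whence the
base 2. -/
lemma jb_gaussianFun : JB 0 2 1 (gaussianFun : (ι → ℝ) → ℂ) := by
  suffices H : ∀ n, ∀ α : List ι, α.length = n → ∀ (β : ι → ℕ) (x : ι → ℝ),
      |∏ j, x j ^ β j| * ‖iterPderiv α gaussianFun x‖ ≤
        2 ^ n * √((n + ∑ j, β j)! : ℝ) by
    refine ⟨contDiff_gaussianFun, fun α β x => (H _ α rfl β x).trans ?_⟩
    rw [one_mul, add_zero]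
    gcongr
    · norm_num
    · omega
  intro n
  induction n using Nat.strong_induction_on with
  | _ n ih =>
    intro α hα β x
    -- The last entry of the list is the derivative applied first, hence the one that acts on the
    -- Gaussian itself.
    rcases List.eq_nil_or_concat α with rfl | ⟨l, j, rfl⟩
    · simp only [List.length_nil] at hα
      subst hα
      simpa [iterPderiv] using abs_prod_mul_gaussianFun_le β x
    rw [List.concat_eq_append] at hα ⊢
    simp only [List.length_append, List.length_singleton] at hα
    subst hα
    set m := l.length with hm
    set P := |∏ i, x i ^ β i|
    set s := ∑ i, β i
    have hP : 0 ≤ P := abs_nonneg _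
    have e0 : iterPderiv (l ++ [j]) gaussianFun = (-1 : ℂ) • iterPderiv l (mulX j gaussianFun) := by
      rw [iter_append, show iterPderiv [j] (gaussianFun : (ι → ℝ) → ℂ) = pderiv j gaussianFun from
        rfl, pderiv_gaussianFun, iter_smul _ _ (contDiff_mulX j contDiff_gaussianFun)]
    rw [e0, iter_mulX j contDiff_gaussianFun, Pi.smul_apply, neg_one_smul, norm_neg, Pi.add_apply]
    have e1 : P * ‖mulX j (iterPderiv l gaussianFun) x‖ ≤
        2 ^ m * √((m + 1 + s)! : ℝ) := by
      have := ih m (by omega) l rfl (β + Pi.single j 1 : ι → ℕ) x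
      rw [prod_pow_add_single, sum_add_single, abs_mul] at this
      rw [mulX, norm_mul, Complex.norm_real, Real.norm_eq_abs, ← mul_assoc]
      rwa [show m + 1 + s = m + (∑ i, β i + 1) by ring]
    have e2 : P * ‖((rem j l).map fun l' => iterPderiv l' gaussianFun).sum x‖ ≤
        2 ^ m * √((m + 1 + s)! : ℝ) := by
      rcases Nat.eq_zero_or_pos l.length with h0 | h0
      · have : l = [] := List.length_eq_zero_iff.1 h0
        subst this
        simp only [rem, List.map_nil, List.sum_nil, Pi.zero_apply, norm_zero, mul_zero]
        positivity
      obtain ⟨k, hk⟩ : ∃ k, l.length = k + 1 := ⟨l.length - 1, by omega⟩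
      have := norm_listSum_le (rem j l) gaussianFun x P (2 ^ k * √((k + s)! : ℝ)) hP
        (fun l' hl => ih k (by omega) l' (by have := rem_mem j l l' hl; omega) β x)
      refine this.trans ?_
      have hl : ((rem j l).length : ℝ) ≤ (k + 1 : ℕ) := by exact_mod_cast hk ▸ rem_length j l
      -- There are at most `k + 1` commutator terms; the drop by two orders leaves two spare factors
      -- in the factorial, which pay for `(k + 1)²` under the root.
      have hs : ((k + 1 : ℕ) : ℝ) * √((k + s)! : ℝ) ≤ √((m + 1 + s)! : ℝ) := by
        rw [← Real.sqrt_sq (show (0 : ℝ) ≤ ((k + 1 : ℕ) : ℝ) by positivity),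
          ← Real.sqrt_mul (by positivity)]
        apply Real.sqrt_le_sqrt
        rw [hm, hk, show k + 1 + 1 + s = (k + s) + 1 + 1 by ring]
        have : (k + 1) ^ 2 * (k + s)! ≤ ((k + s) + 1 + 1)! := by
          rw [Nat.factorial_succ, Nat.factorial_succ, ← mul_assoc, sq]
          gcongr <;> omega
        exact_mod_cast this
      calc ((rem j l).length : ℝ) * (2 ^ k * √((k + s)! : ℝ))
          ≤ ((k + 1 : ℕ) : ℝ) * (2 ^ k * √((k + s)! : ℝ)) := by gcongr
        _ = 2 ^ k * (((k + 1 : ℕ) : ℝ) * √((k + s)! : ℝ)) := by ring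
        _ ≤ 2 ^ m * √((m + 1 + s)! : ℝ) := by
            gcongr
            · norm_num
            · omega
    calc _ ≤ P * ‖mulX j (iterPderiv l gaussianFun) x‖ +
          P * ‖((rem j l).map fun l' => iterPderiv l' gaussianFun).sum x‖ := by
          rw [← mul_add]
          exact mul_le_mul_of_nonneg_left (norm_add_le _ _) hP
      _ ≤ _ := add_le_add e1 e2
      _ = _ := by rw [pow_succ]; ring

/-- The Gaussian as a test function. -/
def gaussian (ι : Type*) [Fintype ι] [DecidableEq ι] : Space (1 / 2) ι :=
  ⟨gaussianFun, jb_gaussianFun.mem_space one_le_two⟩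

lemma integral_gaussianFun_ne_zero : ∫ x : ι → ℝ, gaussianFun x ≠ 0 := by
  have hi : Integrable fun x : ι → ℝ => Real.exp (-(x ⬝ᵥ x) / 2) := by
    have := (integrable_coe (gaussian ι)).re
    exact this
  have e : ∫ x : ι → ℝ, gaussianFun x = ((∫ x : ι → ℝ, Real.exp (-(x ⬝ᵥ x) / 2) : ℝ) : ℂ) :=
    integral_ofReal
  rw [e, Complex.ofReal_ne_zero]
  exact (integral_exp_pos hi).ne'

/-! ### Wave packets -/

/-- The modulation `x ↦ e^{i⟨x, ξ⟩} f(x)` of a test function. -/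
def modulate (ξ : ι → ℝ) (f : Space (1 / 2) ι) : Space (1 / 2) ι :=
  (gaussianFun ξ)⁻¹ • slice (chirp 1 (tensor f (gaussian ι))) ξ

/-- The auxiliary Gaussian in the second variable makes `e^{i⟨y, x⟩} f(x)` a test function of `(x,
y)`. On the slice `y = ξ` it is a nonzero constant, which the definition divides out. -/
lemma modulate_apply (ξ : ι → ℝ) (f : Space (1 / 2) ι) (x : ι → ℝ) :
    (modulate ξ f : (ι → ℝ) → ℂ) x = ker 1 ξ x * (f : (ι → ℝ) → ℂ) x := by
  change (gaussianFun ξ)⁻¹ * (Complex.exp (Complex.I *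
    (((1 : Matrix ι ι ℝ).mulVec ξ ⬝ᵥ x : ℝ) : ℂ)) * ((f : (ι → ℝ) → ℂ) x * gaussianFun ξ)) = _
  have := gaussianFun_ne_zero ξ
  rw [Matrix.one_mulVec, ker]
  simp only [Units.val_one, Int.cast_one, one_mul]
  field_simp

/-- The translated Gaussian `x ↦ e^{-|x - y|^2 / 2}`. -/
def translatedGaussian (y : ι → ℝ) : Space (1 / 2) ι :=
  (gaussianFun y)⁻¹ • slice (compLin (kernelMap 1) (tensor (gaussian ι) (gaussian ι))) y

/-- For `A = 1` the kernel map is `(x, y) ↦ (y, x - y)`, so the slice is the translate times the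
nonzero constant `gaussianFun y`. -/
lemma translatedGaussian_apply (y x : ι → ℝ) :
    (translatedGaussian y : (ι → ℝ) → ℂ) x = gaussianFun (x - y) := by
  change (gaussianFun y)⁻¹ * (gaussianFun (x - (1 : Matrix ι ι ℝ).mulVec (x - y)) *
    gaussianFun (x - y)) = _
  have := gaussianFun_ne_zero y
  rw [Matrix.one_mulVec, sub_sub_cancel]
  field_simp

/-! ### Separation of distributions by tensor products -/

/-- A wave packet on a product is a tensor product of wave packets. -/
lemma modulate_translatedGaussian_eq_tensor (y ξ : ι ⊕ κ → ℝ) :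
    modulate ξ (translatedGaussian y) =
      tensor (modulate (fun a => ξ (.inl a)) (translatedGaussian fun a => y (.inl a)))
        (modulate (fun b => ξ (.inr b)) (translatedGaussian fun b => y (.inr b))) := by
  apply Subtype.ext
  funext w
  change _ = (modulate (fun a => ξ (.inl a)) (translatedGaussian fun a => y (.inl a)) :
      (ι → ℝ) → ℂ) (fun a => w (.inl a)) *
    (modulate (fun b => ξ (.inr b)) (translatedGaussian fun b => y (.inr b)) :
      (κ → ℝ) → ℂ) (fun b => w (.inr b))
  simp only [modulate_apply, translatedGaussian_apply]
  rw [mul_mul_mul_comm]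
  congr 1
  · rw [ker, ker, ker, ← Complex.exp_add]
    congr 1
    simp [dotProduct]
    ring
  · rw [gaussianFun, gaussianFun, gaussianFun, ← Complex.ofReal_mul, ← Real.exp_add]
    congr 2
    simp [dotProduct]
    ring

/-- A distribution that vanishes on all wave packets is zero. -/
lemma dual_eq_zero_of_wavePackets (K : Dual (1 / 2) ι)
    (hK : ∀ y ξ, (K : Space (1 / 2) ι →ₗ[ℂ] ℂ) (modulate ξ (translatedGaussian y)) = 0) :
    K = 0 := by
  apply Subtype.ext
  apply LinearMap.ext
  intro f
  change (K : Space (1 / 2) ι →ₗ[ℂ] ℂ) f = 0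
  set c : ℂ := (((2 * Real.pi) ^ (-(Fintype.card ι : ℝ) / 2) : ℝ) : ℂ) with hc
  -- `kernelMap 0` is `(x, y) ↦ (x, x - y)`, so the slices of `Ψ` are `f` localised by a Gaussian
  -- centred at `y`.
  set Ψ := compLin (kernelMap 0) (tensor f (gaussian ι)) with hΨ
  have hΨa : ∀ x y, (Ψ : (ι ⊕ ι → ℝ) → ℂ) (Sum.elim x y) =
      (f : (ι → ℝ) → ℂ) x * gaussianFun (x - y) := by
    intro x y
    change (f : (ι → ℝ) → ℂ) (x - (0 : Matrix ι ι ℝ).mulVec (x - y)) * gaussianFun (x - y) = _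
    rw [Matrix.zero_mulVec, sub_zero]
  -- Fourier inversion of `f` writes the localised function as an integral over `ξ` of multiples of
  -- wave packets centred at `y`, all annihilated by `K`.
  have h1 : ∀ y, (K : Space (1 / 2) ι →ₗ[ℂ] ℂ) (slice Ψ y) = 0 := by
    intro y
    rw [dual_apply_integral_slice K
      (c • chirp 1 (tensor (translatedGaussian y) (fourier (-1) f))) (slice Ψ y)]
    · rw [integral_eq_zero_of_ae]
      filter_upwards with ξ
      have : slice (c • chirp 1 (tensor (translatedGaussian y) (fourier (-1) f))) ξ =
          (c * (fourier (-1) f : (ι → ℝ) → ℂ) ξ) • modulate ξ (translatedGaussian y) := by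
        apply Subtype.ext
        funext x
        change c * (Complex.exp (Complex.I * (((1 : Matrix ι ι ℝ).mulVec ξ ⬝ᵥ x : ℝ) : ℂ)) *
          ((translatedGaussian y : (ι → ℝ) → ℂ) x * (fourier (-1) f : (ι → ℝ) → ℂ) ξ)) =
          (c * (fourier (-1) f : (ι → ℝ) → ℂ) ξ) *
            (modulate ξ (translatedGaussian y) : (ι → ℝ) → ℂ) x
        rw [modulate_apply, Matrix.one_mulVec, ker]
        simp only [Units.val_one, Int.cast_one, one_mul]
        ring
      rw [this, map_smul, hK, smul_zero]
      rfl
    · intro x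
      rw [slice_apply, hΨa]
      conv_lhs => rw [← fourier_one_fourier_neg_one f]
      rw [fourier_apply, mul_assoc, ← integral_mul_const, ← integral_const_mul]
      congr 1
      funext ξ
      change _ = c * (Complex.exp (Complex.I * (((1 : Matrix ι ι ℝ).mulVec ξ ⬝ᵥ x : ℝ) : ℂ)) *
          ((translatedGaussian y : (ι → ℝ) → ℂ) x * (fourier (-1) f : (ι → ℝ) → ℂ) ξ))
      rw [translatedGaussian_apply, Matrix.one_mulVec, ker]
      simp only [Units.val_one, Int.cast_one, one_mul]
      ring
  -- Integrating the localisations over all centres `y` restores `f` times the total mass of the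
  -- Gaussian, which is nonzero.
  have h2 := dual_apply_integral_slice K Ψ ((∫ x : ι → ℝ, gaussianFun x) • f) (by
    intro x
    simp only [hΨa]
    rw [integral_const_mul, integral_sub_left_eq_self (fun x : ι → ℝ => gaussianFun x)]
    exact mul_comm _ _)
  simp only [h1, integral_zero, map_smul, smul_eq_mul] at h2
  exact (mul_eq_zero.1 h2).resolve_left integral_gaussianFun_ne_zero

/-- A distribution is determined by the operator of which it is the kernel. -/
lemma kernelOp_injective :
    Function.Injective (kernelOp : Dual (1 / 2) (ι ⊕ κ) → Space (1 / 2) κ →ₗ[ℂ] Dual (1 / 2) ι) := by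
  intro K K' h
  rw [← sub_eq_zero]
  refine dual_eq_zero_of_wavePackets _ fun y ξ => ?_
  rw [modulate_translatedGaussian_eq_tensor]
  have : ∀ g f, (K : Space (1 / 2) (ι ⊕ κ) →ₗ[ℂ] ℂ) (tensor g f) =
      (K' : Space (1 / 2) (ι ⊕ κ) →ₗ[ℂ] ℂ) (tensor g f) := fun g f =>
    LinearMap.congr_fun (congrArg Subtype.val (LinearMap.congr_fun h f)) g
  exact sub_eq_zero.2 (this _ _)

/-! ### Kernels and Fourier multipliers -/

/-- The two maps differ by a block unipotent shear of determinant 1, so the Jacobian factor in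
`pullback` does not depend on `A`. -/
lemma det_kernelMap (A : Matrix ι ι ℝ) :
    LinearMap.det (kernelMap A : (ι ⊕ ι → ℝ) →ₗ[ℝ] (ι ⊕ ι → ℝ)) =
      LinearMap.det (kernelMap (0 : Matrix ι ι ℝ) : (ι ⊕ ι → ℝ) →ₗ[ℝ] (ι ⊕ ι → ℝ)) := by
  have : (kernelMap A : (ι ⊕ ι → ℝ) →ₗ[ℝ] (ι ⊕ ι → ℝ)) =
      Matrix.toLin' (Matrix.fromBlocks 1 (-A) 0 1) ∘ₗ
        (kernelMap (0 : Matrix ι ι ℝ) : (ι ⊕ ι → ℝ) →ₗ[ℝ] (ι ⊕ ι → ℝ)) := by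
    apply LinearMap.ext
    intro w
    rw [LinearMap.comp_apply, Matrix.toLin'_apply, Matrix.fromBlocks_mulVec]
    set x : ι → ℝ := fun i => w (.inl i)
    set y : ι → ℝ := fun i => w (.inr i)
    change Sum.elim (x - A.mulVec (x - y)) (x - y) =
      Sum.elim ((1 : Matrix ι ι ℝ).mulVec (x - (0 : Matrix ι ι ℝ).mulVec (x - y)) +
        (-A).mulVec (x - y)) ((0 : Matrix ι ι ℝ).mulVec _ + (1 : Matrix ι ι ℝ).mulVec (x - y))
    simp [Matrix.neg_mulVec, sub_eq_add_neg]
  rw [this, LinearMap.det_comp, LinearMap.det_toLin', Matrix.det_fromBlocks_zero₂₁]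
  simp

/-- A chirp is conjugate to a shear. -/
lemma chirp_fourier_partialFourier (A : Matrix ι κ ℝ) (f g : Space (1 / 2) (ι ⊕ κ))
    (h : ∀ u z, (g : (ι ⊕ κ → ℝ) → ℂ) (Sum.elim u z) =
      (f : (ι ⊕ κ → ℝ) → ℂ) (Sum.elim (u + A.mulVec z) z)) :
    chirp A (fourier 1 (partialFourier 1 f)) = fourier 1 (partialFourier 1 g) := by
  apply Subtype.ext
  funext w
  obtain ⟨η, ζ, rfl⟩ : ∃ η ζ, Sum.elim η ζ = w := ⟨_, _, Sum.elim_comp_inl_inr w⟩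
  change Complex.exp (Complex.I * ((A.mulVec ζ ⬝ᵥ η : ℝ) : ℂ)) *
    (fourier 1 (partialFourier 1 f) : (ι ⊕ κ → ℝ) → ℂ) (Sum.elim η ζ) = _
  rw [fourier_eq_integral_partialFourier, fourier_eq_integral_partialFourier]
  -- Two partial transforms of the same sign reflect the second variable, so both sides become
  -- Fourier integrals in `u` alone, of `f(u, -ζ)` and of `f(u - Aζ, -ζ)`.
  simp only [partialFourier_partialFourier_apply, h, Matrix.mulVec_neg]
  rw [mul_left_comm]
  congr 1
  -- Translating `u` by `Aζ` changes the exponential exactly by the chirp factor.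
  rw [← integral_const_mul, ← integral_sub_right_eq_self _ (A.mulVec ζ)]
  congr 1
  funext u
  have : ker 1 u η = Complex.exp (Complex.I * ((A.mulVec ζ ⬝ᵥ η : ℝ) : ℂ)) *
      ker 1 (u - A.mulVec ζ) η := by
    rw [ker, ker, ← Complex.exp_add, sub_dotProduct]
    congr 1
    push_cast
    simp
    ring
  rw [this, ← sub_eq_add_neg]
  ring

/-- This is `Op_A(a) = Op_0(e^{i⟨A D_ξ, D_x⟩} a)` at the level of kernels: `A` and `a` enter the
right-hand side only through the multiplier. -/
lemma kernel_apply (A : Matrix ι ι ℝ) (a : Dual (1 / 2) (ι ⊕ ι)) (f : Space (1 / 2) (ι ⊕ ι)) :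
    (kernel A a : Space (1 / 2) (ι ⊕ ι) →ₗ[ℂ] ℂ) f =
      ((((2 * Real.pi) ^ (-(Fintype.card ι : ℝ) / 2) : ℝ) : ℂ) *
        ((|LinearMap.det (kernelMap (0 : Matrix ι ι ℝ) : (ι ⊕ ι → ℝ) →ₗ[ℝ] (ι ⊕ ι → ℝ))|⁻¹ : ℝ) : ℂ)) *
      (expMultiplier A a : Space (1 / 2) (ι ⊕ ι) →ₗ[ℂ] ℂ)
        (partialFourier 1 (compLin (kernelMap (0 : Matrix ι ι ℝ)).symm f)) := by
  have h : (expMultiplier A a : Space (1 / 2) (ι ⊕ ι) →ₗ[ℂ] ℂ)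
        (partialFourier 1 (compLin (kernelMap (0 : Matrix ι ι ℝ)).symm f)) =
      (a : Space (1 / 2) (ι ⊕ ι) →ₗ[ℂ] ℂ) (partialFourier 1 (compLin (kernelMap A).symm f)) := by
    change (a : Space (1 / 2) (ι ⊕ ι) →ₗ[ℂ] ℂ) (fourier (-1) (chirp A (fourier 1
      (partialFourier 1 (compLin (kernelMap (0 : Matrix ι ι ℝ)).symm f))))) = _
    -- With all transposes moved to the test function, the chirp becomes a shear and the two full
    -- Fourier transforms cancel. It remains to see that the shear turns the inverse of `kernelMap
    -- 0` into that of `kernelMap A`.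
    rw [chirp_fourier_partialFourier A _ (compLin (kernelMap A).symm f), fourier_neg_fourier]
    intro u z
    change (f : (ι ⊕ ι → ℝ) → ℂ) (Sum.elim (u + A.mulVec z) (u + A.mulVec z - z)) =
      (f : (ι ⊕ ι → ℝ) → ℂ) (Sum.elim (u + A.mulVec z + (0 : Matrix ι ι ℝ).mulVec z)
        (u + A.mulVec z + (0 : Matrix ι ι ℝ).mulVec z - z))
    rw [Matrix.zero_mulVec, add_zero]
  rw [h, ← det_kernelMap A, mul_assoc]
  rfl

/-- Needed to recover the multiplier from the kernel: the functions at which `kernel_apply` tests it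
exhaust all test functions. -/
lemma surjective_partialFourier_compLin (L : (ι ⊕ κ → ℝ) ≃ₗ[ℝ] (ι ⊕ κ → ℝ)) :
    Function.Surjective fun f : Space (1 / 2) (ι ⊕ κ) => partialFourier 1 (compLin L f) := by
  intro g
  refine ⟨compLin L.symm (partialFourier (-1) g), ?_⟩
  have : compLin L (compLin L.symm (partialFourier (-1) g)) = partialFourier (-1) g := by
    apply Subtype.ext
    funext x
    exact congrArg (partialFourier (-1) g : (ι ⊕ κ → ℝ) → ℂ) (L.symm_apply_apply x)
  change partialFourier 1 (compLin L _) = g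
  rw [this]
  have := partialFourier_neg_partialFourier (-1) g
  rwa [neg_neg] at this

lemma det_coe_ne_zero (L : (ι → ℝ) ≃ₗ[ℝ] (ι → ℝ)) :
    LinearMap.det (L : (ι → ℝ) →ₗ[ℝ] (ι → ℝ)) ≠ 0 := L.isUnit_det'.ne_zero

/-- In `kernel_apply` the constant is nonzero and, like the operator on test functions, the same for
both pairs. -/
lemma kernel_eq_kernel_iff (A₁ A₂ : Matrix ι ι ℝ) (a₁ a₂ : Dual (1 / 2) (ι ⊕ ι)) :
    kernel A₁ a₁ = kernel A₂ a₂ ↔ expMultiplier A₁ a₁ = expMultiplier A₂ a₂ := by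
  have hdet := det_coe_ne_zero (kernelMap (0 : Matrix ι ι ℝ))
  have hc : ((((2 * Real.pi) ^ (-(Fintype.card ι : ℝ) / 2) : ℝ) : ℂ) *
      ((|LinearMap.det (kernelMap (0 : Matrix ι ι ℝ) :
        (ι ⊕ ι → ℝ) →ₗ[ℝ] (ι ⊕ ι → ℝ))|⁻¹ : ℝ) : ℂ)) ≠ 0 := by
    rw [← Complex.ofReal_mul, Complex.ofReal_ne_zero]
    positivity
  constructor
  · intro h
    apply Subtype.ext
    apply LinearMap.ext
    intro g
    obtain ⟨f, rfl⟩ := surjective_partialFourier_compLin (kernelMap (0 : Matrix ι ι ℝ)).symm g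
    have := LinearMap.congr_fun (congrArg Subtype.val h) f
    rw [kernel_apply, kernel_apply] at this
    exact mul_left_cancel₀ hc this
  · intro h
    apply Subtype.ext
    apply LinearMap.ext
    intro f
    rw [kernel_apply, kernel_apply, h]

end

end GelfandShilov

end
-- The proposition
theorem proposition2p1 (d : ℕ)
    (a₁ a₂ : GelfandShilov.Dual (1 / 2) (Fin d ⊕ Fin d)) (A₁ A₂ : Matrix (Fin d) (Fin d) ℝ) :
    GelfandShilov.Op A₁ a₁ = GelfandShilov.Op A₂ a₂ ↔
      GelfandShilov.expMultiplier A₂ a₂ = GelfandShilov.expMultiplier A₁ a₁ := by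
  rw [eq_comm (a := GelfandShilov.expMultiplier A₂ a₂), ← GelfandShilov.kernel_eq_kernel_iff]
  exact GelfandShilov.kernelOp_injective.eq_iff
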